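/- Let $n,k\ge 0$ be integers. **Trees.** An $(n,k)$-tree is a sequence $\underline P=(P_1,\dots,P_k)$ of subsets of $\{1,\dots,n\}$ such that for all $i<j$ either $P_i\cap P_j=\emptyset$ or $P_i\subseteq P_j$. It is consistent if $\#\{s<i : P_s\subseteq P_i\}+1\le \#P_i$ for every $i$. For $P\subseteq\{1,\dots,2n\}$ let $\overline P=\{\,i+n \ (\mathrm{mod}\ 2n) : i\in P\,\}$. A symplectic $(n,k)$-tree is a sequence $(P_1,\dots,P_k)$ of subsets of $\{1,\dots,2n\}$ such that for all $i<j$ either $P_i\cap P_j=\emptyset$ or $P_i\subseteq P_j$, and either $\overline{P_i}\cap P_j=\emptyset$ or $\overline{P_i}\subseteq P_j$. It is symplectic consistent if $\#\{s<i : P_s\subseteq P_i\}+\#\{s<i : \overline{P_s}\subseteq P_i\}+1\le\#P_i$ for every $i$. Put $\kappa(\underline P)=\#\{(i,j) : i<j,\ P_i\subseteq P_j\}$ and $\mu(\underline P)=\#\{(i,j): i<j,\ \overline{P_i}\subseteq P_j\}$. **Eigen-directions.** Let $G=\mathrm{SL}(n,\mathbb R)$ with $m=n$, or $G=\mathrm{Sp}(n,\mathbb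 R)$ with $m=2n$, the symplectic form on $\mathbb R^{2n}$ being given by $J=\begin{pmatrix}0&-I\\ I&0\end{pmatrix}$. Let $H\subset G$ be conjugate, by an orthogonal matrix of $G$, to the group of positive diagonal matrices of $G$, and let $E_1,\dots,E_m$ be its eigen-directions: lines with $AE_i=E_i$ for all $A\in H$ and $\mathbb R^m=E_1\oplus\dots\oplus E_m$. In the symplectic case they are numbered so that $JE_i=E_{i+n}$ for $1\le i\le n$. For a set of indices $I$ put $E_I=\bigoplus_{i\in I}E_i$. **Strata.** A $k$-flag in $\mathbb R^m$ is a chain of subspaces $V_1\subset\dots\subset V_k\subset\mathbb R^m$ with $\dim V_i=i$; put $V_0=\{0\}$. The set of $k$-flags has the usual topology and smooth structure of the flag manifold, induced by its embedding $V\mapsto(\text{orthogonal projection onto }V_i)_{1\le i\le k}$ in $(\mathrm{End}\,\mathbb R^m)^k$. Let $$S_{\underline P}=\{V : V \text{ is a } k\text{-flag in }\mathbb R^m,\ V_i\cap V_{i-1}^{\perp}\subseteq E_{P_i}\ \text{for } 1\le i\le k\},$$ $$\widetilde S_{\underline P}=\{X\in\mathrm{Mat}_{m\times k}(\mathbb R)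 : X^tX=I,\ \text{the } i\text{-th column of } X \text{ lies in } E_{P_i}\ \text{for } 1\le i\le k\}.$$ In the symplectic case ($m=2n$) let $S^{sp}_{\underline P}$ be the set of isotropic flags in $S_{\underline P}$ (those with $u^tJv=0$ for all $u,v\in V_k$), and let $\widetilde S^{sp}_{\underline P}=\{X\in\widetilde S_{\underline P}: X^tJX=0\}$. **Proposition.** 1. Let $G=\mathrm{SL}(n,\mathbb R)$ and let $\underline P$ be a consistent $(n,k)$-tree. Then $S_{\underline P}$ is a compact connected smooth manifold without boundary, embedded in the flag manifold, of dimension $$\sum_{i=1}^k\#P_i-k-\kappa(\underline P),$$ and $\widetilde S_{\underline P}$ is a compact smooth manifold without boundary, embedded in $\mathrm{Mat}_{n\times k}(\mathbb R)$, of the same dimension. There are such data for which $\widetilde S_{\underline P}$ is disconnected. 2. Let $G=\mathrm{Sp}(n,\mathbb R)$ and let $\underline P$ be a symplectic consistent $(n,k)$-tree. Then $S^{sp}_{\underline P}$ is a compact connected smooth manifold without boundary, embedded in the flag manifold, of dimension $$\sum_{i=1}^k\#P_i-k-\kappa(\underline P)-\mu(\underline P),$$ and $\widetilde S^{sp}_{\underline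 P}$ is a compact smooth manifold without boundary, embedded in $\mathrm{Mat}_{2n\times k}(\mathbb R)$, of the same dimension. There are such data for which $\widetilde S^{sp}_{\underline P}$ is disconnected. -/

import Mathlib

open scoped Manifold ContDiff

noncomputable section

namespace FlagStrata

/-! ### Matrix groups and eigen-directions -/

/-- The group `SL(n, ℝ)`, as a set of matrices closed under products. -/
def specialLinear (n : ℕ) : Submonoid (Matrix (Fin n) (Fin n) ℝ) :=
  MonoidHom.mker (Matrix.detMonoidHom : Matrix (Fin n) (Fin n) ℝ →* ℝ)

/-- The positive diagonal matrices in the matrix group `G`. -/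
def posDiag {ι : Type} [Fintype ι] [DecidableEq ι] (G : Submonoid (Matrix ι ι ℝ)) :
    Set (Matrix ι ι ℝ) :=
  {D | D ∈ G ∧ ∃ d : ι → ℝ, (∀ i, 0 < d i) ∧ D = Matrix.diagonal d}

/-- `H` is a commutative positive symmetric subgroup of `G`: it is conjugate, by an orthogonal
matrix of `G`, to the group of positive diagonal matrices of `G`. -/
def IsCommPosSymm {ι : Type} [Fintype ι] [DecidableEq ι] (G : Submonoid (Matrix ι ι ℝ))
    (H : Set (Matrix ι ι ℝ)) : Prop :=
  ∃ Q : Matrix ι ι ℝ, Q ∈ G ∧ Q ∈ Matrix.orthogonalGroup ι ℝ ∧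
    H = {A | ∃ D ∈ posDiag G, A = Q * D * Q⁻¹}

/-- `E` lists the eigen-directions of `H`: lines `E i` with `A E_i = E_i` for all `A ∈ H`,
whose direct sum is the whole space. -/
structure IsEigenDirections {ι : Type} [Fintype ι] [DecidableEq ι] (H : Set (Matrix ι ι ℝ))
    (E : ι → Submodule ℝ (EuclideanSpace ℝ ι)) : Prop where
  finrank_eq_one : ∀ i, Module.finrank ℝ (E i) = 1
  invariant : ∀ A ∈ H, ∀ i, (E i).map (Matrix.toEuclideanLin A) = E i
  isInternal : DirectSum.IsInternal E

/-- `E_I = ⨁_{i ∈ I} E_i`. -/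
def coordSpan {ι : Type} [Fintype ι] (E : ι → Submodule ℝ (EuclideanSpace ℝ ι))
    (I : Finset ι) : Submodule ℝ (EuclideanSpace ℝ ι) :=
  ⨆ i ∈ I, E i

/-- The linear map of `ℝ²ⁿ` with matrix `J = (0, -I; I, 0)`. -/
def Jmap (n : ℕ) :
    EuclideanSpace ℝ (Fin n ⊕ Fin n) →ₗ[ℝ] EuclideanSpace ℝ (Fin n ⊕ Fin n) :=
  Matrix.toEuclideanLin (Matrix.J (Fin n) ℝ)

/-! ### Trees -/

/-- For all `i < j` either `P_i ∩ P_j = ∅` or `P_i ⊆ P_j`. -/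
def IsTree {ι : Type} [DecidableEq ι] {k : ℕ} (P : Fin k → Finset ι) : Prop :=
  ∀ i j, i < j → P i ∩ P j = ∅ ∨ P i ⊆ P j

/-- The number of `s < i` with `P_s ⊆ P_i`. -/
def depth {ι : Type} [DecidableEq ι] {k : ℕ} (P : Fin k → Finset ι) (i : Fin k) : ℕ :=
  (Finset.univ.filter fun s : Fin k => s < i ∧ P s ⊆ P i).card

/-- `depth(i) + 1 ≤ #P_i` for all `i`. -/
def IsConsistent {ι : Type} [DecidableEq ι] {k : ℕ} (P : Fin k → Finset ι) : Prop :=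
  ∀ i, depth P i + 1 ≤ (P i).card

/-- The number of pairs `i < j` with `P_i ⊆ P_j`. -/
def kappa {ι : Type} [DecidableEq ι] {k : ℕ} (P : Fin k → Finset ι) : ℕ :=
  (Finset.univ.filter fun p : Fin k × Fin k => p.1 < p.2 ∧ P p.1 ⊆ P p.2).card

/-- The conjugate set. The indices `1, …, 2n` are represented by `Fin n ⊕ Fin n`, the first copy
standing for `1, …, n` and the second for `n + 1, …, 2n`, so that conjugation
`i ↦ i + n (mod 2n)` exchanges the two copies. -/
def conj {n : ℕ} (I : Finset (Fin n ⊕ Fin n)) : Finset (Fin n ⊕ Fin n) :=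
  I.image Sum.swap

/-- In a symplectic tree one also asks, for `i < j`, that the conjugate of `P_i` be disjoint from
`P_j` or contained in `P_j`. -/
def IsSympTree {n k : ℕ} (P : Fin k → Finset (Fin n ⊕ Fin n)) : Prop :=
  ∀ i j, i < j →
    (P i ∩ P j = ∅ ∨ P i ⊆ P j) ∧ (conj (P i) ∩ P j = ∅ ∨ conj (P i) ⊆ P j)

/-- The number of `s < i` such that the conjugate of `P_s` is contained in `P_i`. -/
def coDepth {n k : ℕ} (P : Fin k → Finset (Fin n ⊕ Fin n)) (i : Fin k) : ℕ :=
  (Finset.univ.filter fun s : Fin k => s < i ∧ conj (P s) ⊆ P i).card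

/-- `depth(i) + codepth(i) + 1 ≤ #P_i` for all `i`. -/
def IsSympConsistent {n k : ℕ} (P : Fin k → Finset (Fin n ⊕ Fin n)) : Prop :=
  ∀ i, depth P i + coDepth P i + 1 ≤ (P i).card

/-- The number of pairs `i < j` such that the conjugate of `P_i` is contained in `P_j`. -/
def mu {n k : ℕ} (P : Fin k → Finset (Fin n ⊕ Fin n)) : ℕ :=
  (Finset.univ.filter fun p : Fin k × Fin k => p.1 < p.2 ∧ conj (P p.1) ⊆ P p.2).card

/-! ### Flags -/

/-- A `k`-flag: subspaces `V_1 ⊂ V_2 ⊂ ⋯ ⊂ V_k` with `dim V_i = i`. As indices in `Fin k` start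
at `0`, the subspace `space i` is the one of dimension `i + 1`. -/
structure KFlag (ι : Type) [Fintype ι] (k : ℕ) where
  space : Fin k → Submodule ℝ (EuclideanSpace ℝ ι)
  mono : Monotone space
  finrank_space : ∀ i, Module.finrank ℝ (space i) = i + 1

/-- The usual embedding of the flag manifold in a Euclidean space: a flag is sent to the tuple of
the orthogonal projections onto its members. It induces the topology and the smooth structure
of the flag manifold. -/
def KFlag.proj {ι : Type} [Fintype ι] {k : ℕ} (V : KFlag ι k) :
    Fin k → (EuclideanSpace ℝ ι →L[ℝ] EuclideanSpace ℝ ι) :=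
  fun i => (V.space i).starProjection

instance {ι : Type} [Fintype ι] {k : ℕ} : TopologicalSpace (KFlag ι k) :=
  TopologicalSpace.induced KFlag.proj inferInstance

/-- The member of the flag that precedes `space i` (the zero space for the first one). -/
def KFlag.prev {ι : Type} [Fintype ι] {k : ℕ} (V : KFlag ι k) (i : Fin k) :
    Submodule ℝ (EuclideanSpace ℝ ι) :=
  ⨆ j : Fin k, ⨆ _ : j < i, V.space j

/-- The flag is isotropic: `⟨u, J v⟩ = 0` for `u, v` in its largest member. -/
def KFlag.IsIsotropic {n k : ℕ} (V : KFlag (Fin n ⊕ Fin n) k) : Prop :=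
  ∀ i, ∀ u ∈ V.space i, ∀ v ∈ V.space i, inner ℝ u (Jmap n v) = 0

/-! ### Strata -/

/-- The stratum of frames: `n × k` matrices, given by their columns `X_1, …, X_k`, with
orthonormal columns and `X_i ∈ E_{P_i}`. -/
def frameStratum {ι : Type} [Fintype ι] {k : ℕ} (E : ι → Submodule ℝ (EuclideanSpace ℝ ι))
    (P : Fin k → Finset ι) : Set (Fin k → EuclideanSpace ℝ ι) :=
  {X | Orthonormal ℝ X ∧ ∀ i, X i ∈ coordSpan E (P i)}

/-- The stratum of flags: the flags `V` such that the line `V_i ⊖ V_{i-1}` is contained in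
`E_{P_i}` for every `i`. A frame `X` belongs to `frameStratum E P` if and only if the flag
`(⟨X_1⟩, ⟨X_1, X_2⟩, …, ⟨X_1, …, X_k⟩)` belongs to `flagStratum E P`. -/
def flagStratum {ι : Type} [Fintype ι] {k : ℕ} (E : ι → Submodule ℝ (EuclideanSpace ℝ ι))
    (P : Fin k → Finset ι) : Set (KFlag ι k) :=
  {V | ∀ i, V.space i ⊓ (V.prev i)ᗮ ≤ coordSpan E (P i)}

/-- The symplectic stratum of frames: those of `frameStratum E P` with `Xᵗ J X = 0`. -/
def sympFrameStratum {n k : ℕ}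
    (E : Fin n ⊕ Fin n → Submodule ℝ (EuclideanSpace ℝ (Fin n ⊕ Fin n)))
    (P : Fin k → Finset (Fin n ⊕ Fin n)) : Set (Fin k → EuclideanSpace ℝ (Fin n ⊕ Fin n)) :=
  frameStratum E P ∩ {X | ∀ i j, inner ℝ (X i) (Jmap n (X j)) = 0}

/-- The symplectic stratum of flags: the isotropic flags in `flagStratum E P`. -/
def sympFlagStratum {n k : ℕ}
    (E : Fin n ⊕ Fin n → Submodule ℝ (EuclideanSpace ℝ (Fin n ⊕ Fin n)))
    (P : Fin k → Finset (Fin n ⊕ Fin n)) : Set (KFlag (Fin n ⊕ Fin n) k) :=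
  flagStratum E P ∩ {V | V.IsIsotropic}

/-- Let `e : X → F` realize `X` inside a normed space `F`. The subset `S` of `X`, with its subspace
topology, is a smooth manifold without boundary of dimension `d`, embedded in `F` by `e`. -/
def IsSmoothSubmanifold {X F : Type} [TopologicalSpace X] [NormedAddCommGroup F]
    [NormedSpace ℝ F] (e : X → F) (S : Set X) (d : ℕ) : Prop :=
  ∃ _ : ChartedSpace (EuclideanSpace ℝ (Fin d)) S,
    IsManifold (𝓡 d) ∞ S ∧
      Manifold.IsSmoothEmbedding (𝓡 d) 𝓘(ℝ, F) ∞ (fun x : S => e x)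

end FlagStrata

end

/-! `H` contains an element with distinct eigenvalues, diagonal in an orthonormal basis, so the
eigen-directions are mutually orthogonal. Hence `E_P ⟂ E_Q` for disjoint index sets, and in the
symplectic case `J E_P` is `E` of the conjugate set. For `j < i` the equation `⟨X_j, X_i⟩ = 0` is
therefore automatic unless `P_j ⊆ P_i`, and `⟨J X_j, X_i⟩ = 0` is automatic unless the conjugate of
`P_j` lies in `P_i`. The frame stratum is thus cut out of `∏ E_{P_i}` by `k + κ` equations, and `μ`
more in the symplectic case. Containment lets multiples of `X_j` and `J X_j` be added to the `i`-th
column, which makes these equations a submersion (`IsNested.surjective_frameEqnDeriv`); this gives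
smoothness and the dimension.

A flag is a frame up to the signs of its columns, and the projections onto its members are the
partial sums of the projections onto the lines of the columns. Signs can be fixed locally, so flags
inherit the local parametrizations of frames (`isLocallyParametrized_flags`).

Connectedness of the flags is proved line by line: forgetting the last line has projective spaces as
fibres, nonempty because consistency leaves fewer linear conditions than dimensions, and compactness
carries connectedness up from the base (`isConnected_lineTuple_image`). For frames the same fibres
are spheres, possibly two points, whence the disconnected examples.

Both cases are treated at once through `IsNested`; the special linear one has `J = 0`. -/

noncomputable section

namespace FlagStrata

open Set Filter Topology Function

/-! ### Embedded submanifolds from slice charts -/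

/-- The chart of `Y` obtained from a chart `ψ` of the ambient space that straightens the image of
an embedding `f : Y → F`. -/
def sliceChart {Y F M C : Type} [TopologicalSpace Y] [Nonempty Y] [NormedAddCommGroup F]
    [NormedSpace ℝ F] [NormedAddCommGroup M] [NormedSpace ℝ M] [NormedAddCommGroup C]
    [NormedSpace ℝ C] {f : Y → F} (hf : IsEmbedding f) (L : (M × C) ≃L[ℝ] F)
    (ψ : OpenPartialHomeomorph F F)
    (hψ : ∀ y ∈ ψ.source, y ∈ range f ↔ (L.symm (ψ y)).2 = 0) : OpenPartialHomeomorph Y M where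
  toFun y := (L.symm (ψ (f y))).1
  invFun u := invFun f (ψ.symm (L (u, 0)))
  source := f ⁻¹' ψ.source
  target := (fun u => L (u, 0)) ⁻¹' ψ.target
  map_source' y hy := by
    have h2 := (hψ _ hy).1 (mem_range_self y)
    have h3 : L ((L.symm (ψ (f y))).1, 0) = ψ (f y) := by rw [← h2]; simp
    simpa [h3] using ψ.map_source hy
  map_target' u hu := by
    have h1 := ψ.map_target hu
    have h2 : ψ.symm (L (u, 0)) ∈ range f := (hψ _ h1).2 (by rw [ψ.right_inv hu]; simp)
    simpa [mem_preimage, invFun_eq h2] using h1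
  left_inv' y hy := by
    have h2 := (hψ _ hy).1 (mem_range_self y)
    have h3 : L ((L.symm (ψ (f y))).1, 0) = ψ (f y) := by rw [← h2]; simp
    rw [h3, ψ.left_inv hy, leftInverse_invFun hf.injective]
  right_inv' u hu := by
    have h1 := ψ.map_target hu
    have h2 : ψ.symm (L (u, 0)) ∈ range f := (hψ _ h1).2 (by rw [ψ.right_inv hu]; simp)
    rw [invFun_eq h2, ψ.right_inv hu]; simp
  open_source := ψ.open_source.preimage hf.continuous
  open_target := ψ.open_target.preimage (by fun_prop)
  continuousOn_toFun := by
    have : ContinuousOn (fun y => ψ (f y)) (f ⁻¹' ψ.source) :=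
      ψ.continuousOn.comp hf.continuous.continuousOn (fun _ h => h)
    exact (continuous_fst.comp L.symm.continuous).comp_continuousOn this
  continuousOn_invFun := by
    rw [hf.continuousOn_iff]
    have : ContinuousOn (fun u : M => ψ.symm (L (u, 0))) ((fun u => L (u, 0)) ⁻¹' ψ.target) :=
      ψ.continuousOn_symm.comp (Continuous.continuousOn (by fun_prop)) (fun _ h => h)
    refine this.congr fun u hu => ?_
    have h1 := ψ.map_target hu
    exact invFun_eq ((hψ _ h1).2 (by rw [ψ.right_inv hu]; simp))

section sliceChart

variable {Y F M C : Type} [TopologicalSpace Y] [Nonempty Y] [NormedAddCommGroup F]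
    [NormedSpace ℝ F] [NormedAddCommGroup M] [NormedSpace ℝ M] [NormedAddCommGroup C]
    [NormedSpace ℝ C] {f : Y → F} (hf : IsEmbedding f) (L : (M × C) ≃L[ℝ] F)
    (ψ : OpenPartialHomeomorph F F)
    (hψ : ∀ y ∈ ψ.source, y ∈ range f ↔ (L.symm (ψ y)).2 = 0)

theorem apply_sliceChart_symm {u : M} (hu : L (u, 0) ∈ ψ.target) :
    f ((sliceChart hf L ψ hψ).symm u) = ψ.symm (L (u, 0)) :=
  invFun_eq ((hψ _ (ψ.map_target hu)).2 (by rw [ψ.right_inv hu]; simp))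

end sliceChart

/-- Transition maps between slice charts are restrictions of transition maps of the ambient charts,
hence smooth. In a slice chart and its ambient chart the embedding reads `u ↦ L (u, 0)`, the normal
form of an immersion. -/
theorem isSmoothSubmanifold_of_slices {X F C : Type} [TopologicalSpace X] [NormedAddCommGroup F]
    [NormedSpace ℝ F] [NormedAddCommGroup C] [NormedSpace ℝ C] {e : X → F} (he : IsInducing e)
    (hinj : Injective e) {S : Set X} {d : ℕ} (L : (EuclideanSpace ℝ (Fin d) × C) ≃L[ℝ] F)
    (h : ∀ x ∈ S, ∃ ψ : OpenPartialHomeomorph F F, e x ∈ ψ.source ∧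
      ContDiffOn ℝ ∞ ψ ψ.source ∧ ContDiffOn ℝ ∞ ψ.symm ψ.target ∧
      ∀ y ∈ ψ.source, y ∈ e '' S ↔ (L.symm (ψ y)).2 = 0) :
    IsSmoothSubmanifold e S d := by
  have hf : IsEmbedding (fun x : S => e x) :=
    IsEmbedding.comp ⟨he, hinj⟩ IsEmbedding.subtypeVal
  have hr : range (fun x : S => e x) = e '' S := by
    rw [← image_eq_range]
  choose ψ hmem hsm hsm' hsl using fun x : S => h x x.2
  have hsl' : ∀ x : S, ∀ y ∈ (ψ x).source,
      y ∈ range (fun x : S => e x) ↔ (L.symm (ψ x y)).2 = 0 := by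
    rw [hr]; exact hsl
  let φ : S → OpenPartialHomeomorph S (EuclideanSpace ℝ (Fin d)) := fun x =>
    have : Nonempty S := ⟨x⟩
    sliceChart hf L (ψ x) (hsl' x)
  have happ : ∀ x y, φ x y = (L.symm (ψ x (e y))).1 := fun x y => rfl
  have hsrc : ∀ x, (φ x).source = (fun x : S => e x) ⁻¹' (ψ x).source := fun x => rfl
  have htgt : ∀ x, (φ x).target = (fun u => L (u, 0)) ⁻¹' (ψ x).target := fun x => rfl
  have hsymm : ∀ x u, u ∈ (φ x).target → e ((φ x).symm u) = (ψ x).symm (L (u, 0)) := by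
    intro x u hu
    have : Nonempty S := ⟨x⟩
    exact apply_sliceChart_symm hf L (ψ x) (hsl' x) hu
  let cs : ChartedSpace (EuclideanSpace ℝ (Fin d)) S :=
    { atlas := range φ
      chartAt := φ
      mem_chart_source := fun x => hmem x
      chart_mem_atlas := fun x => mem_range_self x }
  have hman : IsManifold (𝓡 d) ∞ S := by
    refine isManifold_of_contDiffOn _ _ _ ?_
    rintro _ _ ⟨x, rfl⟩ ⟨y, rfl⟩
    have key : ContDiffOn ℝ ∞ (fun u => (L.symm (ψ y ((ψ x).symm (L (u, 0))))).1)
        ((φ x).symm ≫ₕ φ y).source := by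
      have h1 : ContDiffOn ℝ ∞ (fun u : EuclideanSpace ℝ (Fin d) => L (u, 0))
          ((φ x).symm ≫ₕ φ y).source := by fun_prop
      have h2 : ContDiffOn ℝ ∞ (fun u => (ψ x).symm (L (u, 0))) ((φ x).symm ≫ₕ φ y).source :=
        (hsm' x).comp h1 fun u hu => hu.1
      have h3 : ContDiffOn ℝ ∞ (fun u => ψ y ((ψ x).symm (L (u, 0))))
          ((φ x).symm ≫ₕ φ y).source := by
        refine (hsm y).comp h2 fun u hu => ?_
        rw [← hsymm x u hu.1]
        exact hu.2
      exact (contDiff_fst.comp L.symm.contDiff).comp_contDiffOn h3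
    refine (key.congr ?_).mono ?_
    · intro u hu
      change φ y ((φ x).symm u) = _
      rw [happ, hsymm x u hu.1]
    · intro u hu
      exact hu.1
  refine ⟨cs, hman, ⟨?_, hf⟩⟩
  refine ⟨ULift.{0} C, inferInstance, inferInstance, fun x => ?_⟩
  have hmax : φ x ∈ IsManifold.maximalAtlas (𝓡 d) ∞ S :=
    IsManifold.subset_maximalAtlas (mem_range_self x)
  have hmax' : ψ x ∈ IsManifold.maximalAtlas 𝓘(ℝ, F) ∞ F := by
    refine StructureGroupoid.mem_maximalAtlas_of_mem_groupoid _ ?_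
    rw [contDiffGroupoid, mem_groupoid_of_pregroupoid]
    constructor
    · simpa [contDiffPregroupoid] using hsm x
    · simpa [contDiffPregroupoid] using hsm' x
  refine Manifold.IsImmersionAtOfComplement.mk_of_charts
    (((ContinuousLinearEquiv.refl ℝ _).prodCongr ContinuousLinearEquiv.ulift).trans L)
    (φ x) (ψ x) (hmem x) (hmem x) hmax hmax' (fun y hy => hy) ?_
  intro u hu
  have hu' : u ∈ (φ x).target := by simpa using hu
  have := hsymm x u hu'
  simp only [comp_apply, OpenPartialHomeomorph.extend_coe, OpenPartialHomeomorph.extend_coe_symm,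
    modelWithCornersSelf_coe, modelWithCornersSelf_coe_symm, id]
  rw [this, (ψ x).right_inv hu']
  simp

/-! ### Local parametrizations -/

/-- Near `p`, the set `M` is the image of a local analytic parametrization by the vector space `N`
that has a local analytic left inverse. -/
def IsLocallyParametrized {F : Type} (N : Type) [NormedAddCommGroup F] [NormedSpace ℝ F]
    [NormedAddCommGroup N] [NormedSpace ℝ N] (M : Set F) (p : F) : Prop :=
  ∃ (σ : N → F) (ρ : F → N), p ∈ M ∧ ContDiffAt ℝ ω σ (ρ p) ∧ ContDiffAt ℝ ω ρ p ∧
    (∀ᶠ u in 𝓝 (ρ p), σ u ∈ M ∧ ρ (σ u) = u) ∧ ∀ᶠ y in 𝓝 p, y ∈ M → σ (ρ y) = y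

section

variable {F N : Type} [NormedAddCommGroup F] [NormedSpace ℝ F] [NormedAddCommGroup N]
  [NormedSpace ℝ N] {M : Set F} {p : F}

/-- The maps `q` and `r` need be mutually inverse only between the two sets, so the ambient spaces
may have different dimensions. -/
theorem IsLocallyParametrized.map {G : Type} [NormedAddCommGroup G] [NormedSpace ℝ G]
    (h : IsLocallyParametrized N M p) {M' : Set G} {q : F → G} {r : G → F}
    (hq : ContDiffAt ℝ ω q p) (hr : ContDiffAt ℝ ω r (q p))
    (hrq : ∀ᶠ x in 𝓝 p, x ∈ M → q x ∈ M' ∧ r (q x) = x)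
    (hqr : ∀ᶠ y in 𝓝 (q p), y ∈ M' → r y ∈ M ∧ q (r y) = y) :
    IsLocallyParametrized N M' (q p) := by
  obtain ⟨σ, ρ, hp, hσ, hρ, h1, h2⟩ := h
  have hrp : r (q p) = p := (hrq.self_of_nhds hp).2
  have hσp : σ (ρ p) = p := h2.self_of_nhds hp
  refine ⟨q ∘ σ, ρ ∘ r, (hrq.self_of_nhds hp).1, ?_, ?_, ?_, ?_⟩
  · simp only [comp_apply, hrp]
    exact ContDiffAt.comp _ (by rwa [hσp]) hσ
  · exact ContDiffAt.comp _ (by rwa [hrp]) hr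
  · simp only [comp_apply, hrp]
    have hc : Tendsto σ (𝓝 (ρ p)) (𝓝 p) := by simpa [ContinuousAt, hσp] using hσ.continuousAt
    filter_upwards [h1, hc.eventually hrq] with u hu hu'
    exact ⟨(hu' hu.1).1, by rw [(hu' hu.1).2, hu.2]⟩
  · have hc : Tendsto r (𝓝 (q p)) (𝓝 p) := by simpa [ContinuousAt, hrp] using hr.continuousAt
    filter_upwards [hqr, hc.eventually h2] with y hy hy' hyM
    simp only [comp_apply]
    rw [hy' (hy hyM).1, (hy hyM).2]

theorem IsLocallyParametrized.congr_model {N' : Type} [NormedAddCommGroup N'] [NormedSpace ℝ N']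
    (h : IsLocallyParametrized N M p) (L : N ≃L[ℝ] N') : IsLocallyParametrized N' M p := by
  obtain ⟨σ, ρ, hp, hσ, hρ, h1, h2⟩ := h
  refine ⟨σ ∘ L.symm, L ∘ ρ, hp, ?_, L.contDiff.contDiffAt.comp _ hρ, ?_, ?_⟩
  · exact ContDiffAt.comp _ (by simpa using hσ) L.symm.contDiff.contDiffAt
  · have hc : Tendsto L.symm (𝓝 (L (ρ p))) (𝓝 (ρ p)) := by
      simpa [ContinuousAt] using L.symm.continuous.continuousAt (x := L (ρ p))
    filter_upwards [hc.eventually h1] with u hu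
    exact ⟨hu.1, by simp [hu.2]⟩
  · filter_upwards [h2] with y hy hyM
    simpa using hy hyM

/-- The derivatives of a local parametrization and of its left inverse. -/
theorem fderiv_comp_fderiv_eq_id {σ : N → F} {ρ : F → N} (hσp : σ (ρ p) = p)
    (hσ : DifferentiableAt ℝ σ (ρ p)) (hρ : DifferentiableAt ℝ ρ p)
    (h1 : ∀ᶠ u in 𝓝 (ρ p), ρ (σ u) = u) (v : N) :
    fderiv ℝ ρ p (fderiv ℝ σ (ρ p) v) = v := by
  have h3 : HasFDerivAt ρ (fderiv ℝ ρ p) (σ (ρ p)) := by rw [hσp]; exact hρ.hasFDerivAt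
  have h4 := h3.comp (ρ p) hσ.hasFDerivAt
  have h5 : HasFDerivAt (ρ ∘ σ) (ContinuousLinearMap.id ℝ N) (ρ p) :=
    (hasFDerivAt_id (ρ p)).congr_of_eventuallyEq h1
  exact DFunLike.congr_fun (h4.unique h5) v

theorem IsLocallyParametrized.finrank_le [FiniteDimensional ℝ F]
    (h : IsLocallyParametrized N M p) : Module.finrank ℝ N ≤ Module.finrank ℝ F := by
  obtain ⟨σ, ρ, hp, hσ, hρ, h1, h2⟩ := h
  have := fderiv_comp_fderiv_eq_id (h2.self_of_nhds hp) (hσ.differentiableAt (by simp))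
    (hρ.differentiableAt (by simp)) (h1.mono fun u hu => hu.2)
  exact LinearMap.finrank_le_finrank_of_injective (f := (fderiv ℝ σ (ρ p)).toLinearMap)
    (LeftInverse.injective this)

/-- The derivatives satisfy `R T = 1`, so the ambient space is the sum of the range of `T` and the
kernel of `R`. Accordingly `y ↦ (ρ y, P (y - σ (ρ y)))` has invertible derivative. Its second
component vanishes on `M`; conversely, where it vanishes, `y` and `σ (ρ y)` have the same image, so
local injectivity gives `y = σ (ρ y) ∈ M`. -/
theorem IsLocallyParametrized.exists_slice [FiniteDimensional ℝ F] {C : Type}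
    [NormedAddCommGroup C] [NormedSpace ℝ C] (L : (N × C) ≃L[ℝ] F)
    (h : IsLocallyParametrized N M p) :
    ∃ ψ : OpenPartialHomeomorph F F, p ∈ ψ.source ∧
      ContDiffOn ℝ ∞ ψ ψ.source ∧ ContDiffOn ℝ ∞ ψ.symm ψ.target ∧
      ∀ y ∈ ψ.source, y ∈ M ↔ (L.symm (ψ y)).2 = 0 := by
  obtain ⟨σ, ρ, hp, hσ, hρ, h1, h2⟩ := h
  have hσp : σ (ρ p) = p := h2.self_of_nhds hp
  have hRS := fderiv_comp_fderiv_eq_id hσp (hσ.differentiableAt (by simp))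
    (hρ.differentiableAt (by simp)) (h1.mono fun u hu => hu.2)
  set R := fderiv ℝ ρ p with hR
  set T := fderiv ℝ σ (ρ p) with hT
  have : FiniteDimensional ℝ (N × C) := L.symm.toLinearEquiv.finiteDimensional
  have : FiniteDimensional ℝ N := FiniteDimensional.of_surjective
    (LinearMap.fst ℝ N C) Prod.fst_surjective
  have : FiniteDimensional ℝ C := FiniteDimensional.of_surjective
    (LinearMap.snd ℝ N C) Prod.snd_surjective
  have hRsurj : Surjective R := fun v => ⟨T v, hRS v⟩
  have hdim : Module.finrank ℝ R.ker = Module.finrank ℝ C := by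
    have e1 := LinearMap.finrank_range_add_finrank_ker R.toLinearMap
    have e2 := L.toLinearEquiv.finrank_eq
    rw [LinearMap.range_eq_top.2 hRsurj, finrank_top] at e1
    rw [Module.finrank_prod] at e2
    have : Module.finrank ℝ R.ker = Module.finrank ℝ R.toLinearMap.ker := rfl
    omega
  let κ : R.ker ≃L[ℝ] C := ContinuousLinearEquiv.ofFinrankEq hdim
  -- The projector onto the kernel of `R` along the range of `T`.
  let P : F →L[ℝ] R.ker := (ContinuousLinearMap.id ℝ F - T.comp R).codRestrict R.ker
    (fun x => by simp [hRS])
  let Ψ : F → F := fun y => L (ρ y, κ (P (y - σ (ρ y))))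
  let D : F →L[ℝ] F := L.toContinuousLinearMap.comp
    (R.prod (κ.toContinuousLinearMap.comp (P.comp (ContinuousLinearMap.id ℝ F - T.comp R))))
  have hD : Injective D := by
    rw [injective_iff_map_eq_zero]
    intro x hx
    have hx' : (R x, κ (P (x - T (R x)))) = 0 := by
      apply L.injective
      simpa [D] using hx
    rw [Prod.mk_eq_zero] at hx'
    obtain ⟨ha, hb⟩ := hx'
    rw [ha, map_zero, sub_zero, map_eq_zero_iff κ κ.injective] at hb
    have := congrArg Subtype.val hb
    simpa [P, ha] using this
  let D' : F ≃L[ℝ] F := (LinearEquiv.ofInjectiveEndo D.toLinearMap hD).toContinuousLinearEquiv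
  have hD' : (D' : F →L[ℝ] F) = D := by ext x; rfl
  have hσρ : ContDiffAt ℝ ω (fun y => σ (ρ y)) p := hσ.comp p hρ
  have hΨ : ContDiffAt ℝ ω Ψ p := by
    refine L.contDiff.contDiffAt.comp p (hρ.prodMk ?_)
    exact κ.contDiff.contDiffAt.comp p (P.contDiff.contDiffAt.comp p (contDiffAt_id.sub hσρ))
  have hder : HasFDerivAt Ψ (D' : F →L[ℝ] F) p := by
    rw [hD']
    have a1 : HasFDerivAt ρ R p := (hρ.differentiableAt (by simp)).hasFDerivAt
    have a2 : HasFDerivAt σ T (ρ p) := (hσ.differentiableAt (by simp)).hasFDerivAt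
    have a3 := (hasFDerivAt_id p).sub (a2.comp p a1)
    exact L.hasFDerivAt.comp p (a1.prodMk (κ.hasFDerivAt.comp p (P.hasFDerivAt.comp p a3)))
  let ψ₁ := hΨ.toOpenPartialHomeomorph Ψ hder (by simp)
  have hp₁ : p ∈ ψ₁.source := hΨ.mem_toOpenPartialHomeomorph_source hder (by simp)
  have hsymm : ContDiffAt ℝ ω ψ₁.symm (ψ₁ p) := by
    refine ψ₁.contDiffAt_symm (f₀' := D') (ψ₁.map_source hp₁) ?_ ?_ <;>
    rw [ψ₁.left_inv hp₁]
    · exact hder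
    · exact hΨ
  let ψ₂ := ψ₁.restrContDiff ℝ ω (by simp)
  have hp₂ : p ∈ ψ₂.source := ⟨hp₁, hΨ, hsymm⟩
  have hψ₂ : ∀ y, ψ₂ y = Ψ y := fun y => rfl
  have hc : Tendsto (fun y => σ (ρ y)) (𝓝 p) (𝓝 p) := by
    simpa [ContinuousAt, hσp] using hσρ.continuousAt
  -- On `s` both `y` and `σ (ρ y)` stay in the domain where `Ψ` is injective.
  let s : Set F := {y | (y ∈ M → σ (ρ y) = y) ∧ (σ (ρ y) ∈ M ∧ ρ (σ (ρ y)) = ρ y) ∧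
    σ (ρ y) ∈ ψ₂.source ∧ (σ (ρ y) ∈ M → σ (ρ (σ (ρ y))) = σ (ρ y))}
  have hs : s ∈ 𝓝 p := by
    filter_upwards [h2, hρ.continuousAt.eventually h1,
      hc.eventually (ψ₂.open_source.mem_nhds hp₂), hc.eventually h2] with y b1 b2 b3 b4
    exact ⟨b1, b2, b3, b4⟩
  have hsub : (ψ₂.restr s).source ⊆ ψ₂.source := fun y hy => hy.1
  refine ⟨ψ₂.restr s, ?_, ?_, ?_, ?_⟩
  · rw [ψ₂.restr_source]
    exact ⟨hp₂, mem_interior_iff_mem_nhds.2 hs⟩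
  · exact ((ψ₁.contDiffOn_restrContDiff_source (𝕜 := ℝ) (n := ω) (by simp)).mono hsub).of_le le_top
  · refine ((ψ₁.contDiffOn_restrContDiff_target (𝕜 := ℝ) (n := ω) (by simp)).mono ?_).of_le le_top
    intro y hy
    exact hy.1
  · intro y hy
    rw [ψ₂.restr_source] at hy
    obtain ⟨hy1, hy2⟩ := hy
    obtain ⟨b1, ⟨b2, b2'⟩, b3, b4⟩ := interior_subset hy2
    have e1 : (ψ₂.restr s) y = Ψ y := rfl
    rw [e1]
    constructor
    · intro hyM
      simp [Ψ, b1 hyM]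
    · intro h0
      have h0' : κ (P (y - σ (ρ y))) = 0 := by simpa [Ψ] using h0
      have e2 : Ψ (σ (ρ y)) = Ψ y := by
        simp only [Ψ]
        rw [b2', h0', sub_self, map_zero, map_zero]
      have e3 : σ (ρ y) = y := ψ₂.injOn b3 hy1 (by rw [hψ₂, hψ₂, e2])
      rw [← e3]; exact b2

end

/-- The parameter space may change with the point, as kernels of derivatives do; only its dimension
is fixed. -/
theorem isSmoothSubmanifold_of_isLocallyParametrized {X F : Type} [TopologicalSpace X]
    [NormedAddCommGroup F] [NormedSpace ℝ F] [FiniteDimensional ℝ F] {e : X → F}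
    (he : IsInducing e) (hinj : Injective e) {S : Set X} (hS : S.Nonempty) {d : ℕ}
    (h : ∀ x ∈ S, ∃ (N : Type) (_ : NormedAddCommGroup N) (_ : NormedSpace ℝ N),
      FiniteDimensional ℝ N ∧ Module.finrank ℝ N = d ∧ IsLocallyParametrized N (e '' S) (e x)) :
    IsSmoothSubmanifold e S d := by
  have h' : ∀ x ∈ S, IsLocallyParametrized (EuclideanSpace ℝ (Fin d)) (e '' S) (e x) := by
    intro x hx
    obtain ⟨N, _, _, hN, hd, hp⟩ := h x hx
    exact hp.congr_model (ContinuousLinearEquiv.ofFinrankEq (by simp [hd]))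
  obtain ⟨x₀, hx₀⟩ := hS
  -- A point of `S` ensures `d ≤ dim F`, so that the natural subtraction below is exact.
  have hle := (h' x₀ hx₀).finrank_le
  let L : (EuclideanSpace ℝ (Fin d) × EuclideanSpace ℝ (Fin (Module.finrank ℝ F - d))) ≃L[ℝ] F :=
    ContinuousLinearEquiv.ofFinrankEq (by simp at hle ⊢; omega)
  exact isSmoothSubmanifold_of_slices he hinj L fun x hx => (h' x hx).exists_slice L

/-- A level set of a submersion is locally parametrized by the kernel of the derivative. -/
theorem isLocallyParametrized_of_submersion {F G : Type} [NormedAddCommGroup F] [NormedSpace ℝ F]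
    [FiniteDimensional ℝ F] [NormedAddCommGroup G] [NormedSpace ℝ G] [FiniteDimensional ℝ G]
    {g : F → G} {g' : F →L[ℝ] G} {p : F} (hg : ContDiffAt ℝ ω g p) (hg' : HasFDerivAt g g' p)
    (hsurj : Surjective g') (hp : g p = 0) :
    IsLocallyParametrized g'.ker {x | g x = 0} p := by
  have : CompleteSpace F := FiniteDimensional.complete ℝ F
  have hstrict : HasStrictFDerivAt g g' p := hg.hasStrictFDerivAt' hg' (by simp)
  have hrange : g'.range = ⊤ := LinearMap.range_eq_top.2 hsurj
  -- Completing `g` by a projection onto the kernel of `g'` gives a local analytic diffeomorphism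
  -- that carries the level set to `{0} × g'.ker`.
  obtain ⟨π, hπ⟩ : ∃ π : F →L[ℝ] g'.ker, ∀ x : g'.ker, π x = x :=
    Submodule.ClosedComplemented.of_finiteDimensional g'.ker
  let I : ImplicitFunctionData ℝ F G g'.ker :=
    { leftFun := g
      leftDeriv := g'
      rightFun := fun x => π (x - p)
      rightDeriv := π
      pt := p
      hasStrictFDerivAt_leftFun := hstrict
      hasStrictFDerivAt_rightFun :=
        π.hasStrictFDerivAt.comp p ((hasStrictFDerivAt_id p).sub_const p)
      range_leftDeriv := hrange
      range_rightDeriv := LinearMap.range_eq_of_proj hπ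
      isCompl_ker := LinearMap.isCompl_of_proj hπ }
  let φ := I.toOpenPartialHomeomorph
  have hφ : ∀ x, φ x = (g x, π (x - p)) := fun x => rfl
  have hpφ : p ∈ φ.source := I.pt_mem_toOpenPartialHomeomorph_source
  have hφp : φ p = (0, 0) := by simp [hφ, hp]
  have hsm : ContDiffAt ℝ ω φ p :=
    hg.prodMk (π.contDiff.contDiffAt.comp p (contDiffAt_id.sub contDiffAt_const))
  have hsymm : ContDiffAt ℝ ω φ.symm (0, 0) := by
    rw [← hφp]
    refine φ.contDiffAt_symm (φ.map_source hpφ) (f₀' :=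
      g'.equivProdOfSurjectiveOfIsCompl π hrange (LinearMap.range_eq_of_proj hπ)
        (LinearMap.isCompl_of_proj hπ)) ?_ ?_ <;> rw [φ.left_inv hpφ]
    · exact I.hasStrictFDerivAt.hasFDerivAt
    · exact hsm
  have htgt : (0, 0) ∈ φ.target := hφp ▸ φ.map_source hpφ
  refine ⟨fun u => φ.symm (0, u), fun x => π (x - p), hp, ?_, ?_, ?_, ?_⟩
  · simp only [sub_self, map_zero]
    exact ContDiffAt.comp _ hsymm (contDiffAt_const.prodMk contDiffAt_id)
  · exact π.contDiff.contDiffAt.comp p (contDiffAt_id.sub contDiffAt_const)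
  · simp only [sub_self, map_zero]
    have hc : ContinuousAt (fun u : g'.ker => ((0 : G), u)) 0 := by fun_prop
    filter_upwards [hc.eventually (φ.open_target.mem_nhds htgt)] with u hu
    have := φ.right_inv hu
    rw [hφ, Prod.mk.injEq] at this
    exact this
  · filter_upwards [φ.open_source.mem_nhds hpφ] with y hy hyM
    have h0 : φ y = (0, π (y - p)) := by rw [hφ, show g y = 0 from hyM]
    rw [← h0, φ.left_inv hy]

/-! ### Isotropic frames subordinate to a tuple of subspaces -/

section frames

variable {V : Type} [NormedAddCommGroup V] [InnerProductSpace ℝ V] {k : ℕ}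

/-- Orthonormal frames `X` with `X_i ∈ W_i` that are isotropic for the form `⟨u, J v⟩`. -/
def isoFrames (J : V →L[ℝ] V) (W : Fin k → Submodule ℝ V) : Set (Fin k → V) :=
  {X | Orthonormal ℝ X ∧ (∀ i, X i ∈ W i) ∧ ∀ i j, inner ℝ (X i) (J (X j)) = 0}

/-- The subspaces `W_j` and `J W_j` are, for `j < i`, orthogonal to `W_i` or contained in it; the
relations `A` and `B` select pairs for which containment holds. -/
structure IsNested (J : V →L[ℝ] V) (W : Fin k → Submodule ℝ V) (A B : Fin k → Fin k → Prop) :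
    Prop where
  skew : ∀ x y, inner ℝ (J x) y = -inner ℝ x (J y)
  -- Required only if `B` holds for some pair, so that `J = 0` with empty `B` is allowed.
  isometry : ∀ i j, B i j → ∀ x y, inner ℝ (J x) (J y) = inner ℝ x y
  lt_left : ∀ j i, A j i → j < i
  le_left : ∀ j i, A j i → W j ≤ W i
  lt_right : ∀ j i, B j i → j < i
  le_right : ∀ j i, B j i → ∀ x ∈ W j, J x ∈ W i
  orth_left : ∀ j i, j < i → ¬ A j i → ∀ x ∈ W j, ∀ y ∈ W i, inner ℝ x y = 0
  orth_right : ∀ j i, j < i → ¬ B j i → ∀ x ∈ W j, ∀ y ∈ W i, inner ℝ (J x) y = 0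

variable {J : V →L[ℝ] V} {W : Fin k → Submodule ℝ V} {A B : Fin k → Fin k → Prop}

theorem inner_apply_self_of_skew (h : ∀ x y, inner ℝ (J x) y = -inner ℝ x (J y)) (x : V) :
    inner ℝ x (J x) = 0 := by
  have := h x x
  rw [real_inner_comm] at this
  linarith

/-- The inclusion of the `i`-th factor of `∏ W_i` in the ambient space. -/
def factorCLM (W : Fin k → Submodule ℝ V) (i : Fin k) : ((i : Fin k) → W i) →L[ℝ] V :=
  (W i).subtypeL.comp (ContinuousLinearMap.proj i)

theorem factorCLM_apply (X : (i : Fin k) → W i) (i : Fin k) : factorCLM W i X = X i := rfl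

/-- The equations of `isoFrames J W` in `∏ W_i`. -/
def frameEqn (J : V →L[ℝ] V) (W : Fin k → Submodule ℝ V) (A B : Fin k → Fin k → Prop)
    (X : (i : Fin k) → W i) :
    ({a : Fin k × Fin k // A a.1 a.2} → ℝ) × ({b : Fin k × Fin k // B b.1 b.2} → ℝ) ×
      (Fin k → ℝ) :=
  (fun a => inner ℝ (factorCLM W a.1.2 X) (factorCLM W a.1.1 X),
   fun b => inner ℝ (factorCLM W b.1.2 X) (J (factorCLM W b.1.1 X)),
   fun i => inner ℝ (factorCLM W i X) (factorCLM W i X) - 1)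

/-- The derivative of `frameEqn J W A B` at `X`. -/
def frameEqnDeriv (J : V →L[ℝ] V) (W : Fin k → Submodule ℝ V) (A B : Fin k → Fin k → Prop)
    (X : (i : Fin k) → W i) :
    ((i : Fin k) → W i) →L[ℝ] ({a : Fin k × Fin k // A a.1 a.2} → ℝ) ×
      ({b : Fin k × Fin k // B b.1 b.2} → ℝ) × (Fin k → ℝ) :=
  (ContinuousLinearMap.pi fun a : {a : Fin k × Fin k // A a.1 a.2} =>
    (fderivInnerCLM ℝ ((X a.1.2 : V), (X a.1.1 : V))).comp
      ((factorCLM W a.1.2).prod (factorCLM W a.1.1))).prod <|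
  (ContinuousLinearMap.pi fun b : {b : Fin k × Fin k // B b.1 b.2} =>
    (fderivInnerCLM ℝ ((X b.1.2 : V), J (X b.1.1 : V))).comp
      ((factorCLM W b.1.2).prod (J.comp (factorCLM W b.1.1)))).prod <|
  ContinuousLinearMap.pi fun i : Fin k =>
    (fderivInnerCLM ℝ ((X i : V), (X i : V))).comp ((factorCLM W i).prod (factorCLM W i))

theorem hasFDerivAt_frameEqn (X : (i : Fin k) → W i) :
    HasFDerivAt (frameEqn J W A B) (frameEqnDeriv J W A B X) X := by
  classical
  refine HasFDerivAt.prodMk ?_ (HasFDerivAt.prodMk ?_ ?_)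
  · exact hasFDerivAt_pi.2 fun a =>
      (factorCLM W a.1.2).hasFDerivAt.inner ℝ (factorCLM W a.1.1).hasFDerivAt
  · exact hasFDerivAt_pi.2 fun b =>
      (factorCLM W b.1.2).hasFDerivAt.inner ℝ (J.comp (factorCLM W b.1.1)).hasFDerivAt
  · exact hasFDerivAt_pi.2 fun i =>
      ((factorCLM W i).hasFDerivAt.inner ℝ (factorCLM W i).hasFDerivAt).sub_const 1

open Classical in
theorem contDiff_frameEqn : ContDiff ℝ ω (frameEqn J W A B) := by
  refine ContDiff.prodMk ?_ (ContDiff.prodMk ?_ ?_)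
  · exact contDiff_pi.2 fun a => (factorCLM W a.1.2).contDiff.inner ℝ (factorCLM W a.1.1).contDiff
  · exact contDiff_pi.2 fun b =>
      (factorCLM W b.1.2).contDiff.inner ℝ (J.comp (factorCLM W b.1.1)).contDiff
  · exact contDiff_pi.2 fun i =>
      ((factorCLM W i).contDiff.inner ℝ (factorCLM W i).contDiff).sub contDiff_const

/-- Pairs `j < i` outside `A` or `B` satisfy their equation by orthogonality of the subspaces. Pairs
in the other order follow from symmetry of the inner product and skewness of `J`, and skewness also
gives `⟨X_i, J X_i⟩ = 0`. -/
theorem IsNested.frameEqn_eq_zero_iff (h : IsNested J W A B) (X : (i : Fin k) → W i) :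
    frameEqn J W A B X = 0 ↔ (fun i => (X i : V)) ∈ isoFrames J W := by
  simp only [frameEqn, Prod.mk_eq_zero, funext_iff, Pi.zero_apply, factorCLM_apply, Subtype.forall,
    Prod.forall, isoFrames, mem_ofPred_eq, orthonormal_iff_ite]
  constructor
  · rintro ⟨h1, h2, h3⟩
    have o1 : ∀ i j, j < i → inner ℝ (X j : V) (X i : V) = 0 := by
      intro i j hij
      by_cases hA : A j i
      · rw [real_inner_comm]; exact h1 j i hA
      · exact h.orth_left j i hij hA _ (X j).2 _ (X i).2
    have o2 : ∀ i j, j < i → inner ℝ (J (X j : V)) (X i : V) = 0 := by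
      intro i j hij
      by_cases hB : B j i
      · rw [real_inner_comm]; exact h2 j i hB
      · exact h.orth_right j i hij hB _ (X j).2 _ (X i).2
    refine ⟨fun i j => ?_, fun i => (X i).2, fun i j => ?_⟩
    · rcases lt_trichotomy i j with hij | rfl | hij
      · rw [if_neg hij.ne, o1 j i hij]
      · rw [if_pos rfl]; linarith [h3 i]
      · rw [if_neg hij.ne', real_inner_comm, o1 i j hij]
    · rcases lt_trichotomy i j with hij | rfl | hij
      · have := h.skew (X i) (X j)
        rw [o2 j i hij] at this
        linarith
      · exact inner_apply_self_of_skew h.skew _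
      · rw [real_inner_comm, o2 i j hij]
  · rintro ⟨h1, -, h3⟩
    refine ⟨fun j i hA => ?_, fun j i hB => h3 _ _, fun i => ?_⟩
    · rw [h1, if_neg (h.lt_left j i hA).ne']
    · rw [h1, if_pos rfl, sub_self]

/-- By isotropy the `X_j` and the `J X_j` are mutually orthogonal, so a combination of them has its
coefficients as inner products. The vector `y i` uses only indices selected by `A` and `B`, which
keeps it in `W i`. As those indices precede `i`, the linearized equations are triangular: for `j <
i`, `y j` does not affect the equations of the pair `(j, i)`. -/
theorem IsNested.surjective_frameEqnDeriv (h : IsNested J W A B) {X : (i : Fin k) → W i}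
    (hX : (fun i => (X i : V)) ∈ isoFrames J W) : Surjective (frameEqnDeriv J W A B X) := by
  classical
  rintro ⟨b, c, e⟩
  obtain ⟨h1, -, h3⟩ := hX
  rw [orthonormal_iff_ite] at h1
  let β : Fin k → Fin k → ℝ := fun j i => if hA : A j i then b ⟨(j, i), hA⟩ else 0
  let γ : Fin k → Fin k → ℝ := fun j i => if hB : B j i then c ⟨(j, i), hB⟩ else 0
  have hβ : ∀ j i, i ≤ j → β j i = 0 := fun j i hij =>
    dif_neg fun hA => (h.lt_left j i hA).not_ge hij
  have hγ : ∀ j i, i ≤ j → γ j i = 0 := fun j i hij =>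
    dif_neg fun hB => (h.lt_right j i hB).not_ge hij
  -- The factor one half compensates for the derivative `2 ⟨X_i, y_i⟩` of the squared norm.
  let y : Fin k → V := fun i =>
    ∑ j, β j i • (X j : V) + ∑ j, γ j i • J (X j) + (e i / 2) • (X i : V)
  have hy : ∀ i, y i ∈ W i := by
    intro i
    refine add_mem (add_mem (sum_mem fun j _ => ?_) (sum_mem fun j _ => ?_))
      (Submodule.smul_mem _ _ (X i).2)
    · by_cases hA : A j i
      · exact Submodule.smul_mem _ _ (h.le_left j i hA (X j).2)
      · simp [β, hA]
    · by_cases hB : B j i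
      · exact Submodule.smul_mem _ _ (h.le_right j i hB _ (X j).2)
      · simp [γ, hB]
  have f1 : ∀ i l, inner ℝ (y i) (X l : V) = β l i + if i = l then e i / 2 else 0 := by
    intro i l
    have e0 : ∀ j, inner ℝ (J (X j : V)) (X l : V) = 0 := fun j => by
      rw [real_inner_comm]; exact h3 l j
    simp only [y, inner_add_left, sum_inner, inner_smul_left, e0, h1]
    simp
  have f2 : ∀ i l, inner ℝ (y i) (J (X l : V)) = γ l i := by
    intro i l
    -- With empty `B` the map `J` need not be an isometry, but then all `γ` vanish.
    by_cases hB : ∃ p q, B p q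
    · obtain ⟨p, q, hB⟩ := hB
      simp only [y, inner_add_left, sum_inner, inner_smul_left, h3, h.isometry p q hB, h1]
      simp
    · push Not at hB
      simp only [y, inner_add_left, sum_inner, inner_smul_left, h3]
      simp [γ, hB]
  refine ⟨fun i => ⟨y i, hy i⟩, ?_⟩
  refine Prod.ext (funext fun a => ?_) (Prod.ext (funext fun a => ?_) (funext fun i => ?_))
  · obtain ⟨⟨j, i⟩, hA⟩ := a
    have hji : j < i := h.lt_left j i hA
    change inner ℝ (X i : V) (y j) + inner ℝ (y i) (X j : V) = b ⟨(j, i), hA⟩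
    rw [real_inner_comm, f1, f1, hβ i j hji.le, if_neg hji.ne, if_neg hji.ne']
    simp [β, hA]
  · obtain ⟨⟨j, i⟩, hB⟩ := a
    have hji : j < i := h.lt_right j i hB
    change inner ℝ (X i : V) (J (y j)) + inner ℝ (y i) (J (X j : V)) = c ⟨(j, i), hB⟩
    have e1 : inner ℝ (X i : V) (J (y j)) = -γ i j := by
      rw [← f2, real_inner_comm (J (X i : V)), h.skew, neg_neg]
    rw [e1, f2, hγ i j hji.le]
    simp [γ, hB]
  · change inner ℝ (X i : V) (y i) + inner ℝ (y i) (X i : V) = e i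
    rw [real_inner_comm, f1, hβ i i le_rfl, if_pos rfl]
    ring

/-- The level set in `∏ W_i` is carried to the ambient space by inclusion, with the orthogonal
projections as left inverse; the dimension is rank-nullity. -/
theorem IsNested.isLocallyParametrized_isoFrames [FiniteDimensional ℝ V] (h : IsNested J W A B)
    {X : Fin k → V} (hX : X ∈ isoFrames J W) :
    ∃ (N : Type) (_ : NormedAddCommGroup N) (_ : NormedSpace ℝ N), FiniteDimensional ℝ N ∧
      Module.finrank ℝ N + (Nat.card {a : Fin k × Fin k // A a.1 a.2} +
        Nat.card {b : Fin k × Fin k // B b.1 b.2} + k) = ∑ i, Module.finrank ℝ (W i) ∧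
      IsLocallyParametrized N (isoFrames J W) X := by
  classical
  let x : (i : Fin k) → W i := fun i => ⟨X i, hX.2.1 i⟩
  have hx : (fun i => (x i : V)) ∈ isoFrames J W := hX
  have hsurj := h.surjective_frameEqnDeriv hx
  have hp := isLocallyParametrized_of_submersion contDiff_frameEqn.contDiffAt
    (hasFDerivAt_frameEqn x) hsurj ((h.frameEqn_eq_zero_iff x).2 hx)
  refine ⟨(frameEqnDeriv J W A B x).ker, inferInstance, inferInstance, inferInstance, ?_, ?_⟩
  · have e1 := LinearMap.finrank_range_add_finrank_ker (frameEqnDeriv J W A B x).toLinearMap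
    rw [LinearMap.range_eq_top.2 hsurj, finrank_top, Module.finrank_pi_fintype,
      Module.finrank_prod, Module.finrank_prod, Module.finrank_fintype_fun_eq_card,
      Module.finrank_fintype_fun_eq_card, Module.finrank_fintype_fun_eq_card, Fintype.card_fin] at e1
    rw [← e1, Nat.card_eq_fintype_card, Nat.card_eq_fintype_card]
    ring
  · let q : ((i : Fin k) → W i) →L[ℝ] (Fin k → V) := ContinuousLinearMap.pi (factorCLM W)
    let r : (Fin k → V) →L[ℝ] ((i : Fin k) → W i) := ContinuousLinearMap.pi fun i =>
      (W i).orthogonalProjectionOnto.comp (ContinuousLinearMap.proj i)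
    have hrq : ∀ y, r (q y) = y := fun y => funext fun i =>
      (W i).orthogonalProjectionOnto_mem_subspace_eq_self (y i)
    refine hp.map (q := q) (r := r) q.contDiff.contDiffAt r.contDiff.contDiffAt
      (Eventually.of_forall fun y hy => ⟨(h.frameEqn_eq_zero_iff y).1 hy, hrq y⟩)
      (Eventually.of_forall fun Y hY => ?_)
    have e2 : q (r Y) = Y := funext fun i =>
      congrArg Subtype.val ((W i).orthogonalProjectionOnto_mem_subspace_eq_self ⟨Y i, hY.2.1 i⟩)
    exact ⟨(h.frameEqn_eq_zero_iff (r Y)).2 (show q (r Y) ∈ _ by rwa [e2]), e2⟩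

theorem isCompact_isoFrames [FiniteDimensional ℝ V] : IsCompact (isoFrames J W) := by
  classical
  refine Metric.isCompact_of_isClosed_isBounded ?_ ?_
  · have : isoFrames J W = (⋂ i, ⋂ j, {X | inner ℝ (X i) (X j) = if i = j then (1 : ℝ) else 0}) ∩
        ((⋂ i, {X | X i ∈ W i}) ∩ ⋂ i, ⋂ j, {X | inner ℝ (X i) (J (X j)) = 0}) := by
      ext X
      simp [isoFrames, orthonormal_iff_ite]
    rw [this]
    refine IsClosed.inter (isClosed_iInter fun i => isClosed_iInter fun j => ?_) (IsClosed.inter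
      (isClosed_iInter fun i => ?_) (isClosed_iInter fun i => isClosed_iInter fun j => ?_))
    · exact isClosed_eq (by fun_prop) continuous_const
    · exact (W i).closed_of_finiteDimensional.preimage (continuous_apply i)
    · exact isClosed_eq (by fun_prop) continuous_const
  · refine (Metric.isBounded_closedBall (x := (0 : Fin k → V)) (r := 1)).subset fun X hX => ?_
    rw [mem_closedBall_zero_iff, pi_norm_le_iff_of_nonneg zero_le_one]
    exact fun i => (hX.1.1 i).le

/-- Partial orthonormal frames can be extended if the subspaces are large enough. -/
theorem IsNested.exists_extension [FiniteDimensional ℝ V] (h : IsNested J W A B) (i : Fin k)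
    (hi : Nat.card {j // A j i} + Nat.card {j // B j i} < Module.finrank ℝ (W i)) (X : Fin k → V)
    (hX : ∀ j, X j ∈ W j) :
    ∃ y ∈ W i, y ≠ 0 ∧ ∀ j < i, inner ℝ (X j) y = 0 ∧ inner ℝ (J (X j)) y = 0 := by
  classical
  -- Only the pairs in `A` and `B` impose conditions on `W i`; by `hi` there are fewer of them than
  -- dimensions.
  let T : W i →ₗ[ℝ] ({j // A j i} → ℝ) × ({j // B j i} → ℝ) :=
    ((LinearMap.pi fun j : {j // A j i} => innerₛₗ ℝ (X j)).prod
      (LinearMap.pi fun j : {j // B j i} => innerₛₗ ℝ (J (X j)))).comp (W i).subtype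
  have hT : T.ker ≠ ⊥ := by
    refine LinearMap.ker_ne_bot_of_finrank_lt ?_
    rw [Module.finrank_prod, Module.finrank_fintype_fun_eq_card,
      Module.finrank_fintype_fun_eq_card, ← Nat.card_eq_fintype_card, ← Nat.card_eq_fintype_card]
    exact hi
  obtain ⟨y, hy, hy0⟩ := Submodule.exists_mem_ne_zero_of_ne_bot hT
  have hy' : T y = 0 := hy
  rw [Prod.ext_iff] at hy'
  refine ⟨y, y.2, by simpa using hy0, fun j hj => ⟨?_, ?_⟩⟩
  · by_cases hA : A j i
    · exact congrFun hy'.1 ⟨j, hA⟩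
    · exact h.orth_left j i hj hA _ (hX j) _ y.2
  · by_cases hB : B j i
    · exact congrFun hy'.2 ⟨j, hB⟩
    · exact h.orth_right j i hj hB _ (hX j) _ y.2

end frames

/-! ### Connectedness of the space of frames up to signs -/

/-- A compact set is preconnected if it is mapped onto a preconnected set with preconnected
fibres. -/
theorem isPreconnected_of_image_of_fibers {X Y : Type} [TopologicalSpace X] [TopologicalSpace Y]
    [T2Space Y] {K : Set X} (hK : IsCompact K) {f : X → Y} (hf : Continuous f)
    (hL : IsPreconnected (f '' K)) (hfib : ∀ p ∈ f '' K, IsPreconnected (K ∩ f ⁻¹' {p})) :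
    IsPreconnected K := by
  rw [isPreconnected_closed_iff]
  rintro C D hC hD hsub ⟨x, hxK, hxC⟩ ⟨y, hyK, hyD⟩
  rw [isPreconnected_closed_iff] at hL
  -- By compactness both pieces have closed images. These meet over some point of the base, whose
  -- connected fibre then meets both pieces.
  have hC' := ((hK.inter_right hC).image hf).isClosed
  have hD' := ((hK.inter_right hD).image hf).isClosed
  obtain ⟨p, hp, ⟨u, hu, rfl⟩, ⟨v, hv, hvp⟩⟩ := hL _ _ hC' hD' (by
      rintro _ ⟨z, hz, rfl⟩
      rcases hsub hz with h | h
      · exact Or.inl ⟨z, ⟨hz, h⟩, rfl⟩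
      · exact Or.inr ⟨z, ⟨hz, h⟩, rfl⟩)
    ⟨f x, ⟨x, hxK, rfl⟩, ⟨x, ⟨hxK, hxC⟩, rfl⟩⟩ ⟨f y, ⟨y, hyK, rfl⟩, ⟨y, ⟨hyK, hyD⟩, rfl⟩⟩
  obtain ⟨z, hz, hzCD⟩ := (isPreconnected_closed_iff.1 (hfib _ hp)) C D hC hD
    (inter_subset_left.trans hsub) ⟨u, ⟨hu.1, rfl⟩, hu.2⟩ ⟨v, ⟨hv.1, hvp⟩, hv.2⟩
  exact ⟨z, hz.1, hzCD⟩

section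

variable {V : Type} [NormedAddCommGroup V] [InnerProductSpace ℝ V]

/-- The orthogonal projections onto the lines spanned by the members of an orthonormal frame. -/
def lineTuple {k : ℕ} (X : Fin k → V) : Fin k → (V →L[ℝ] V) :=
  fun i => InnerProductSpace.rankOne ℝ (X i) (X i)

theorem continuous_rankOne_self :
    Continuous fun x : V => InnerProductSpace.rankOne ℝ x x := by
  simp only [InnerProductSpace.rankOne_def]
  fun_prop

theorem continuous_lineTuple {k : ℕ} : Continuous (lineTuple : (Fin k → V) → _) :=
  continuous_pi fun i => continuous_rankOne_self.comp (continuous_apply i)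

theorem eq_smul_of_rankOne_self_eq {x z : V} (hx : ‖x‖ = 1)
    (h : InnerProductSpace.rankOne ℝ z z = InnerProductSpace.rankOne ℝ x x) :
    x = inner ℝ z x • z := by
  have := DFunLike.congr_fun h x
  simpa [hx] using this.symm

theorem rankOne_neg_self (z : V) :
    InnerProductSpace.rankOne ℝ (-z) (-z) = InnerProductSpace.rankOne ℝ z z := by
  simp

variable {J : V →L[ℝ] V} {W : ℕ → Submodule ℝ V} {k : ℕ}

theorem snoc_mem_isoFrames (hJ : ∀ x y, inner ℝ (J x) y = -inner ℝ x (J y)) {X : Fin k → V}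
    (hX : X ∈ isoFrames J fun i : Fin k => W i) {z : V} (hz : z ∈ W k) (hz1 : ‖z‖ = 1)
    (h : ∀ j, inner ℝ (X j) z = 0 ∧ inner ℝ (J (X j)) z = 0) :
    (Fin.snoc X z : Fin (k + 1) → V) ∈ isoFrames J fun i : Fin (k + 1) => W i := by
  obtain ⟨h1, h2, h3⟩ := hX
  have h4 : ∀ j, inner ℝ (X j) (J z) = 0 := fun j => by
    have := hJ (X j) z
    rw [(h j).2] at this
    linarith
  rw [orthonormal_iff_ite] at h1
  refine ⟨orthonormal_iff_ite.2 fun i j => ?_, fun i => ?_, fun i j => ?_⟩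
  · refine Fin.lastCases ?_ (fun i => ?_) i <;> refine Fin.lastCases ?_ (fun j => ?_) j
    · simp [hz1]
    · have : Fin.last k ≠ j.castSucc := (Fin.castSucc_lt_last j).ne'
      simpa [this] using (real_inner_comm _ _).trans (h j).1
    · have : i.castSucc ≠ Fin.last k := (Fin.castSucc_lt_last i).ne
      simp [this, (h i).1]
    · simp [h1]
  · refine Fin.lastCases ?_ (fun i => ?_) i
    · simpa using hz
    · simpa using h2 i
  · refine Fin.lastCases ?_ (fun i => ?_) i <;> refine Fin.lastCases ?_ (fun j => ?_) j
    · simpa using inner_apply_self_of_skew hJ z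
    · simpa [real_inner_comm] using (h j).2
    · simpa using h4 i
    · simpa using h3 i j

theorem init_mem_isoFrames {Z : Fin (k + 1) → V}
    (hZ : Z ∈ isoFrames J fun i : Fin (k + 1) => W i) :
    (Fin.init Z : Fin k → V) ∈ isoFrames J fun i : Fin k => W i :=
  ⟨hZ.1.comp _ (Fin.castSucc_injective k), fun i => hZ.2.1 i.castSucc,
    fun i j => hZ.2.2 i.castSucc j.castSucc⟩

theorem lineTuple_snoc (X : Fin k → V) (z : V) :
    lineTuple (Fin.snoc X z : Fin (k + 1) → V) =
      (Fin.snoc (lineTuple X) (InnerProductSpace.rankOne ℝ z z) : Fin (k + 1) → V →L[ℝ] V) := by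
  funext i
  refine Fin.lastCases ?_ (fun i => ?_) i <;> simp [lineTuple]

/-- The fibres of the map that forgets the last line are projective spaces. -/
theorem isPreconnected_fiber_lineTuple (hJ : ∀ x y, inner ℝ (J x) y = -inner ℝ x (J y))
    {X : Fin k → V} (hX : X ∈ isoFrames J fun i : Fin k => W i) {y : V} (hy : y ∈ W k)
    (hy0 : y ≠ 0) (hXy : ∀ j, inner ℝ (X j) y = 0 ∧ inner ℝ (J (X j)) y = 0) :
    IsPreconnected (lineTuple '' (isoFrames J fun i : Fin (k + 1) => W i) ∩
      (Fin.init : (Fin (k + 1) → V →L[ℝ] V) → (Fin k → V →L[ℝ] V)) ⁻¹' {lineTuple X}) := by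
  -- The admissible nonzero vectors on the closed side of `y`. This set is star-shaped about `y` and
  -- meets every admissible line, since `v` and `-v` span the same line; without the sign condition
  -- it would be disconnected in dimension one.
  let C : Set V := {v | v ∈ W k ∧ (∀ j, inner ℝ (X j) v = 0 ∧ inner ℝ (J (X j)) v = 0) ∧
    v ≠ 0 ∧ 0 ≤ inner ℝ y v}
  have hyy : 0 < inner ℝ y y := real_inner_self_pos.2 hy0
  have hC : IsPreconnected C := by
    refine (StarConvex.isPathConnected (s := C) (a := y) ?_
      (show y ∈ C from ⟨hy, hXy, hy0, hyy.le⟩)).isConnected.2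
    rintro v ⟨hv, hXv, hv0, hyv⟩ a b ha hb hab
    have e1 : inner ℝ y (a • y + b • v) = a * inner ℝ y y + b * inner ℝ y v := by
      rw [inner_add_right, inner_smul_right, inner_smul_right]
    refine ⟨add_mem (Submodule.smul_mem _ _ hy) (Submodule.smul_mem _ _ hv), fun j => ?_, ?_, ?_⟩
    · simp [inner_add_right, inner_smul_right, hXy j, hXv j]
    · rcases ha.eq_or_lt with rfl | ha
      · obtain rfl : b = 1 := by linarith
        simpa using hv0
      · intro h0
        rw [h0, inner_zero_right] at e1
        have := mul_pos ha hyy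
        have := mul_nonneg hb hyv
        linarith
    · rw [e1]; positivity
  let F : V → (Fin (k + 1) → V →L[ℝ] V) := fun v =>
    Fin.snoc (lineTuple X) (InnerProductSpace.rankOne ℝ (‖v‖⁻¹ • v) (‖v‖⁻¹ • v))
  have hF : ContinuousOn F C := by
    have h1 : ContinuousOn (fun v : V => ‖v‖⁻¹ • v) C :=
      (continuousOn_id.norm.inv₀ fun v hv => norm_ne_zero_iff.2 hv.2.2.1).smul continuousOn_id
    have h2 := continuous_rankOne_self.comp_continuousOn h1
    refine continuousOn_pi.2 fun i => ?_
    refine Fin.lastCases ?_ (fun i => ?_) i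
    · simpa only [F, Fin.snoc_last] using! h2
    · simpa [F] using continuousOn_const
  convert hC.image F hF using 1
  ext p
  constructor
  · rintro ⟨⟨Z, hZ, rfl⟩, hp⟩
    -- A frame over the same lines as `X` differs from it by scalars, so its last vector satisfies
    -- the conditions imposed by `X`.
    have hrank : ∀ j : Fin k, InnerProductSpace.rankOne ℝ (Z j.castSucc) (Z j.castSucc) =
        InnerProductSpace.rankOne ℝ (X j) (X j) := fun j => congrFun hp j
    have hx : ∀ j : Fin k, X j = inner ℝ (Z j.castSucc) (X j) • Z j.castSucc := fun j =>
      eq_smul_of_rankOne_self_eq (hX.1.1 j) (hrank j)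
    have hzl : ‖Z (Fin.last k)‖ = 1 := hZ.1.1 _
    have hX0 : ∀ j, inner ℝ (X j) (Z (Fin.last k)) = 0 ∧
        inner ℝ (J (X j)) (Z (Fin.last k)) = 0 := by
      intro j
      have e1 : inner ℝ (J (Z j.castSucc)) (Z (Fin.last k)) = 0 := by
        rw [real_inner_comm, hZ.2.2]
      rw [hx j, map_smul, inner_smul_left, inner_smul_left,
        hZ.1.2 (Fin.castSucc_lt_last j).ne, e1]
      simp
    have hsnoc : lineTuple Z = F (Z (Fin.last k)) := by
      funext i
      refine Fin.lastCases ?_ (fun i => ?_) i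
      · simp [F, lineTuple, hzl]
      · simpa [F, lineTuple] using hrank i
    have hFneg : F (-Z (Fin.last k)) = F (Z (Fin.last k)) := by
      simp only [F, norm_neg, smul_neg, rankOne_neg_self]
    have hz0 : Z (Fin.last k) ≠ 0 := norm_ne_zero_iff.1 (by rw [hzl]; exact one_ne_zero)
    rcases le_total 0 (inner ℝ y (Z (Fin.last k))) with h | h
    · exact ⟨Z (Fin.last k), ⟨hZ.2.1 (Fin.last k), hX0, hz0, h⟩, hsnoc.symm⟩
    · refine ⟨-Z (Fin.last k), ⟨neg_mem (hZ.2.1 (Fin.last k)), fun j => ?_, neg_ne_zero.2 hz0, ?_⟩, ?_⟩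
      · simp [inner_neg_right, hX0 j]
      · rw [inner_neg_right]; linarith
      · rw [hFneg, hsnoc]
  · rintro ⟨v, ⟨hv, hXv, hv0, -⟩, rfl⟩
    refine ⟨⟨Fin.snoc X (‖v‖⁻¹ • v), snoc_mem_isoFrames hJ hX (Submodule.smul_mem _ _ hv)
      (norm_smul_inv_norm hv0) fun j => ?_, lineTuple_snoc _ _⟩, ?_⟩
    · simp [inner_smul_right, hXv j]
    · simp [F]

/-- Induction along the maps that forget the last line, surjective by `h`. Indexing `W` by `ℕ` makes
the truncated problem use the same family. -/
theorem isConnected_lineTuple_image [FiniteDimensional ℝ V]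
    (hJ : ∀ x y, inner ℝ (J x) y = -inner ℝ x (J y)) (k : ℕ)
    (h : ∀ m < k, ∀ X : Fin m → V, (∀ j : Fin m, X j ∈ W j) →
      ∃ y ∈ W m, y ≠ 0 ∧ ∀ j, inner ℝ (X j) y = 0 ∧ inner ℝ (J (X j)) y = 0) :
    IsConnected (lineTuple '' isoFrames J fun i : Fin k => W i) := by
  induction k with
  | zero =>
    refine ⟨Nonempty.image _ ⟨fun i => i.elim0, ?_⟩, subsingleton_of_subsingleton.isPreconnected⟩
    exact ⟨⟨fun i => i.elim0, fun i => i.elim0⟩, fun i => i.elim0, fun i => i.elim0⟩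
  | succ k ih =>
    have ih' := ih fun m hm => h m (hm.trans k.lt_succ_self)
    have himage : (Fin.init : (Fin (k + 1) → V →L[ℝ] V) → (Fin k → V →L[ℝ] V)) ''
        (lineTuple '' isoFrames J fun i : Fin (k + 1) => W i) =
        lineTuple '' isoFrames J fun i : Fin k => W i := by
      ext p
      constructor
      · rintro ⟨_, ⟨Z, hZ, rfl⟩, rfl⟩
        exact ⟨Fin.init Z, init_mem_isoFrames hZ, rfl⟩
      · rintro ⟨X, hX, rfl⟩
        obtain ⟨y, hy, hy0, hXy⟩ := h k k.lt_succ_self X hX.2.1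
        refine ⟨_, ⟨Fin.snoc X (‖y‖⁻¹ • y), snoc_mem_isoFrames hJ hX (Submodule.smul_mem _ _ hy)
          (norm_smul_inv_norm hy0) fun j => ?_, rfl⟩, ?_⟩
        · simp [inner_smul_right, hXy j]
        · rw [lineTuple_snoc, Fin.init_snoc]
    refine ⟨Nonempty.of_image (by rw [himage]; exact ih'.1), ?_⟩
    refine isPreconnected_of_image_of_fibers
      (f := (Fin.init : (Fin (k + 1) → V →L[ℝ] V) → (Fin k → V →L[ℝ] V)))
      (isCompact_isoFrames.image continuous_lineTuple)
      (continuous_pi fun i => continuous_apply _) ?_ ?_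
    · rw [himage]; exact ih'.2
    · rw [himage]
      rintro _ ⟨X, hX, rfl⟩
      obtain ⟨y, hy, hy0, hXy⟩ := h k k.lt_succ_self X hX.2.1
      exact isPreconnected_fiber_lineTuple hJ hX hy hy0 hXy

end

/-! ### From frames to flags -/

section

variable {V : Type} [NormedAddCommGroup V] [InnerProductSpace ℝ V] {k : ℕ}

/-- The map `(p_1, …, p_k) ↦ (p_1, p_1 + p_2, …, p_1 + ⋯ + p_k)`. -/
def partialSum (k : ℕ) (E : Type) [NormedAddCommGroup E] [NormedSpace ℝ E] :
    (Fin k → E) →L[ℝ] (Fin k → E) :=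
  ContinuousLinearMap.pi fun i => ∑ j ∈ Finset.Iic i, ContinuousLinearMap.proj j

theorem partialSum_apply {E : Type} [NormedAddCommGroup E] [NormedSpace ℝ E] (p : Fin k → E)
    (i : Fin k) : partialSum k E p i = ∑ j ∈ Finset.Iic i, p j := by
  simp [partialSum]

theorem ker_partialSum (E : Type) [NormedAddCommGroup E] [NormedSpace ℝ E] :
    (partialSum k E).toLinearMap.ker = ⊥ := by
  rw [LinearMap.ker_eq_bot']
  intro p hp
  have hp' : ∀ i, ∑ j ∈ Finset.Iic i, p j = 0 := fun i => by
    rw [← partialSum_apply]; exact congrFun hp i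
  funext i
  induction i using WellFoundedLT.induction with
  | ind i ih => ?_
  have h1 := hp' i
  rw [← Finset.Iio_insert, Finset.sum_insert (by simp)] at h1
  rwa [Finset.sum_eq_zero fun j hj => ih j (Finset.mem_Iio.1 hj), add_zero] at h1

variable {J : V →L[ℝ] V} {W : Fin k → Submodule ℝ V}

theorem sign_smul_mem_isoFrames {X : Fin k → V} (hX : X ∈ isoFrames J W) {s : Fin k → ℝ}
    (hs : ∀ i, s i * s i = 1) : (fun i => s i • X i) ∈ isoFrames J W := by
  obtain ⟨h1, h2, h3⟩ := hX
  rw [orthonormal_iff_ite] at h1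
  refine ⟨orthonormal_iff_ite.2 fun i j => ?_, fun i => Submodule.smul_mem _ _ (h2 i),
    fun i j => ?_⟩
  · rw [inner_smul_left, inner_smul_right, h1]
    split_ifs with hij
    · subst hij; simpa using hs i
    · simp
  · rw [map_smul, inner_smul_left, inner_smul_right, h3]
    simp

theorem lineTuple_sign_smul (X : Fin k → V) {s : Fin k → ℝ} (hs : ∀ i, s i * s i = 1) :
    lineTuple (fun i => s i • X i) = lineTuple X := by
  funext i
  simp [lineTuple, smul_smul, hs i]

/-- Lines near a given one have preferred unit vectors. -/
def liftLines (X₀ : Fin k → V) (p : Fin k → (V →L[ℝ] V)) : Fin k → V :=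
  fun i => (√(inner ℝ (X₀ i) (p i (X₀ i))))⁻¹ • p i (X₀ i)

/-- The projection onto the line of `X_i` sends `X₀ i` to `⟨X_i, X₀ i⟩ X_i`; normalizing recovers
`X_i` up to the sign of that inner product. -/
theorem liftLines_lineTuple (X₀ X : Fin k → V) :
    liftLines X₀ (lineTuple X) =
      fun i => (|inner ℝ (X i) (X₀ i)|⁻¹ * inner ℝ (X i) (X₀ i)) • X i := by
  funext i
  have : inner ℝ (X₀ i) (lineTuple X i (X₀ i)) = inner ℝ (X i) (X₀ i) ^ 2 := by
    simp [lineTuple, inner_smul_right, real_inner_comm (X i) (X₀ i), sq]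
  rw [liftLines, this, Real.sqrt_sq_eq_abs]
  simp [lineTuple, smul_smul]

theorem contDiff_lineTuple : ContDiff ℝ ω (lineTuple : (Fin k → V) → _) := by
  refine contDiff_pi.2 fun i => ?_
  simp only [lineTuple, InnerProductSpace.rankOne_def]
  have h : ContDiff ℝ ω fun X : Fin k → V => X i := contDiff_apply ℝ V i
  exact ((innerSL ℝ).contDiff.comp h).smulRight h

theorem contDiffAt_liftLines (X₀ : Fin k → V) {p : Fin k → (V →L[ℝ] V)}
    (hp : ∀ i, 0 < (inner ℝ (X₀ i) (p i (X₀ i)) : ℝ)) : ContDiffAt ℝ ω (liftLines X₀) p := by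
  refine contDiffAt_pi.2 fun i => ?_
  have h : ContDiffAt ℝ ω (fun p : Fin k → (V →L[ℝ] V) => p i (X₀ i)) p :=
    ((contDiff_apply ℝ (V →L[ℝ] V) i).clm_apply contDiff_const).contDiffAt
  have h' := (contDiffAt_const (c := X₀ i)).inner ℝ h
  exact ((h'.sqrt (hp i).ne').inv (Real.sqrt_pos.2 (hp i)).ne').smul h

/-- Near `X₀` all `⟨X_i, X₀ i⟩` are positive, so `liftLines X₀` is a local analytic inverse of
`lineTuple` on frames. The injective linear map `partialSum` then has a linear left inverse. -/
theorem isLocallyParametrized_flags [FiniteDimensional ℝ V] {N : Type} [NormedAddCommGroup N]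
    [NormedSpace ℝ N] {X₀ : Fin k → V} (h : IsLocallyParametrized N (isoFrames J W) X₀)
    (hX₀ : X₀ ∈ isoFrames J W) :
    IsLocallyParametrized N ((fun X => partialSum k (V →L[ℝ] V) (lineTuple X)) '' isoFrames J W)
      (partialSum k (V →L[ℝ] V) (lineTuple X₀)) := by
  have h0 : ∀ i, inner ℝ (X₀ i) (X₀ i) = (1 : ℝ) := fun i => by simp [hX₀.1.1 i]
  have hval : ∀ i, inner ℝ (X₀ i) (lineTuple X₀ i (X₀ i)) = (1 : ℝ) := fun i => by
    simp [lineTuple, hX₀.1.1 i]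
  have hlines : IsLocallyParametrized N (lineTuple '' isoFrames J W) (lineTuple X₀) := by
    refine h.map (r := liftLines X₀) contDiff_lineTuple.contDiffAt
      (contDiffAt_liftLines X₀ fun i => (hval i).symm ▸ one_pos) ?_ ?_
    · have hpos : ∀ᶠ X : Fin k → V in 𝓝 X₀, ∀ i, 0 < (inner ℝ (X i) (X₀ i) : ℝ) := by
        rw [eventually_all]
        intro i
        have hc : Continuous (fun X : Fin k → V => (inner ℝ (X i) (X₀ i) : ℝ)) :=
          (continuous_apply i).inner continuous_const
        exact hc.continuousAt.eventually (lt_mem_nhds (zero_lt_one.trans_eq (h0 i).symm))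
      filter_upwards [hpos] with X hX hXf
      refine ⟨mem_image_of_mem _ hXf, ?_⟩
      rw [liftLines_lineTuple]
      funext i
      rw [abs_of_pos (hX i), inv_mul_cancel₀ (hX i).ne', one_smul]
    · have hpos : ∀ᶠ p : Fin k → (V →L[ℝ] V) in 𝓝 (lineTuple X₀),
          ∀ i, 0 < (inner ℝ (X₀ i) (p i (X₀ i)) : ℝ) := by
        rw [eventually_all]
        intro i
        have hc : Continuous (fun p : Fin k → (V →L[ℝ] V) => (inner ℝ (X₀ i) (p i (X₀ i)) : ℝ)) :=
          continuous_const.inner ((continuous_apply i).clm_apply continuous_const)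
        exact hc.continuousAt.eventually (lt_mem_nhds (zero_lt_one.trans_eq (hval i).symm))
      filter_upwards [hpos] with p hp hpM
      obtain ⟨X, hX, rfl⟩ := hpM
      have hne : ∀ i, inner ℝ (X i) (X₀ i) ≠ 0 := by
        intro i hi
        have := hp i
        simp [lineTuple, hi] at this
      have hs : ∀ i, (|inner ℝ (X i) (X₀ i)|⁻¹ * inner ℝ (X i) (X₀ i)) *
          (|inner ℝ (X i) (X₀ i)|⁻¹ * inner ℝ (X i) (X₀ i)) = 1 := by
        intro i
        have h1 := abs_mul_abs_self (inner ℝ (X i) (X₀ i))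
        have h2 : |inner ℝ (X i) (X₀ i)| ≠ 0 := abs_ne_zero.2 (hne i)
        field_simp
        rw [sq_abs]
      rw [liftLines_lineTuple]
      exact ⟨sign_smul_mem_isoFrames hX hs, lineTuple_sign_smul X hs⟩
  obtain ⟨r, hr⟩ := LinearMap.exists_leftInverse_of_injective _
    (ker_partialSum (k := k) (V →L[ℝ] V))
  have hr' : ∀ p, r (partialSum k (V →L[ℝ] V) p) = p := fun p => DFunLike.congr_fun hr p
  rw [show (fun X => partialSum k (V →L[ℝ] V) (lineTuple X)) '' isoFrames J W =
    partialSum k (V →L[ℝ] V) '' (lineTuple '' isoFrames J W) from (image_image _ _ _).symm]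
  refine hlines.map (q := partialSum k (V →L[ℝ] V)) (r := r)
    (partialSum k (V →L[ℝ] V)).contDiff.contDiffAt
    r.toContinuousLinearMap.contDiff.contDiffAt
    (Eventually.of_forall fun p hp => ⟨mem_image_of_mem _ hp, hr' p⟩)
    (Eventually.of_forall ?_)
  rintro _ ⟨p, hp, rfl⟩
  rw [hr']
  exact ⟨hp, rfl⟩

end

/-! ### Flags and frames -/

section

variable {ι : Type} [Fintype ι] {k : ℕ}

theorem isInducing_proj : IsInducing (KFlag.proj : KFlag ι k → _) := ⟨rfl⟩

theorem injective_proj : Injective (KFlag.proj : KFlag ι k → _) := by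
  intro V V' h
  have : V.space = V'.space := funext fun i => Submodule.starProjection_inj.1 (congrFun h i)
  cases V; cases V'; cases this; rfl

theorem finrank_span_image_Iic {X : Fin k → EuclideanSpace ℝ ι} (hX : Orthonormal ℝ X)
    (i : Fin k) : Module.finrank ℝ (Submodule.span ℝ (X '' Iic i)) = i + 1 := by
  have h : LinearIndependent ℝ fun j : Iic i => X j :=
    hX.linearIndependent.comp _ Subtype.val_injective
  rw [image_eq_range, finrank_span_eq_card h]
  simp

/-- The flag spanned by an orthonormal frame. -/
def frameFlag (X : Fin k → EuclideanSpace ℝ ι) (hX : Orthonormal ℝ X) : KFlag ι k where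
  space i := Submodule.span ℝ (X '' Iic i)
  mono _ _ h := Submodule.span_mono (image_mono (Iic_subset_Iic.2 h))
  finrank_space := finrank_span_image_Iic hX

theorem starProjection_span_image_Iic {X : Fin k → EuclideanSpace ℝ ι} (hX : Orthonormal ℝ X)
    (i : Fin k) : (Submodule.span ℝ (X '' Iic i)).starProjection =
      ∑ j ∈ Finset.Iic i, InnerProductSpace.rankOne ℝ (X j) (X j) := by
  ext1 v
  refine Submodule.eq_starProjection_of_mem_of_inner_eq_zero ?_ ?_
  · rw [_root_.sum_apply]
    refine sum_mem fun j hj => ?_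
    rw [InnerProductSpace.rankOne_apply]
    exact Submodule.smul_mem _ _ (Submodule.subset_span ⟨j, Finset.mem_Iic.1 hj, rfl⟩)
  · intro w hw
    induction hw using Submodule.span_induction with
    | mem x hx =>
      obtain ⟨l, hl, rfl⟩ := hx
      have hl' : l ≤ i := hl
      have := orthonormal_iff_ite.1 hX
      simp [inner_sub_left, sum_inner, inner_smul_left, this, hl', real_inner_comm]
    | zero => simp
    | add x y _ _ hx hy => rw [inner_add_right, hx, hy, add_zero]
    | smul a x _ hx => rw [inner_smul_right, hx, mul_zero]

theorem proj_eq_partialSum_of_space_eq {V : KFlag ι k} {X : Fin k → EuclideanSpace ℝ ι}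
    (hX : Orthonormal ℝ X) (h : ∀ i, V.space i = Submodule.span ℝ (X '' Iic i)) :
    V.proj = partialSum k _ (lineTuple X) := by
  funext i
  rw [partialSum_apply]
  simp only [KFlag.proj, lineTuple]
  rw [← starProjection_span_image_Iic hX]
  congr 1
  exact h i

theorem KFlag.prev_le (V : KFlag ι k) (i : Fin k) : V.prev i ≤ V.space i :=
  iSup₂_le fun _ hj => V.mono hj.le

theorem KFlag.le_prev (V : KFlag ι k) {i j : Fin k} (h : j < i) : V.space j ≤ V.prev i :=
  le_iSup₂_of_le j h le_rfl

theorem KFlag.finrank_prev_le (V : KFlag ι k) (i : Fin k) :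
    Module.finrank ℝ (V.prev i) ≤ i := by
  by_cases h : (i : ℕ) = 0
  · have : V.prev i = ⊥ := by
      refine eq_bot_iff.2 (iSup₂_le fun j hj => absurd hj ?_)
      rw [Fin.lt_def]; omega
    rw [this, finrank_bot]
    exact Nat.zero_le _
  · let l : Fin k := ⟨i - 1, by omega⟩
    have : V.prev i ≤ V.space l := iSup₂_le fun j hj => V.mono (by
      rw [Fin.lt_def] at hj
      rw [Fin.le_def]
      simp only [l]; omega)
    have h2 := Submodule.finrank_mono this
    rw [V.finrank_space] at h2
    simp only [l] at h2
    omega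

/-- By dimension each `V_i ⊖ V_{i-1}` contains a unit vector; these vectors are orthogonal, and
counting dimensions shows that they span the flag. -/
theorem KFlag.exists_frame (V : KFlag ι k) : ∃ X : Fin k → EuclideanSpace ℝ ι, Orthonormal ℝ X ∧
    (∀ i, X i ∈ V.space i ⊓ (V.prev i)ᗮ) ∧ ∀ i, V.space i = Submodule.span ℝ (X '' Iic i) := by
  have h1 : ∀ i, ∃ x, x ∈ V.space i ⊓ (V.prev i)ᗮ ∧ ‖x‖ = 1 := by
    intro i
    have hne : V.space i ⊓ (V.prev i)ᗮ ≠ ⊥ := by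
      intro h0
      have := Submodule.sup_orthogonal_inf_of_hasOrthogonalProjection (V.prev_le i)
      rw [inf_comm, h0, sup_bot_eq] at this
      have h2 := V.finrank_prev_le i
      rw [this, V.finrank_space] at h2
      omega
    obtain ⟨y, hy, hy0⟩ := Submodule.exists_mem_ne_zero_of_ne_bot hne
    exact ⟨‖y‖⁻¹ • y, Submodule.smul_mem _ _ hy, norm_smul_inv_norm hy0⟩
  choose X hX hX1 using h1
  have horth : ∀ i j, i < j → inner ℝ (X i) (X j) = 0 := fun i j hij =>
    (hX j).2 _ (V.le_prev hij (hX i).1)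
  have hon : Orthonormal ℝ X := by
    refine ⟨hX1, fun i j hij => ?_⟩
    rcases lt_or_gt_of_ne hij with h | h
    · exact horth i j h
    · rw [real_inner_comm]; exact horth j i h
  refine ⟨X, hon, hX, fun i => (Submodule.eq_of_le_of_finrank_eq ?_ ?_).symm⟩
  · rw [Submodule.span_le]
    rintro _ ⟨j, hj, rfl⟩
    exact V.mono hj (hX j).1
  · rw [finrank_span_image_Iic hon, V.finrank_space]

/-- Flags that are isotropic for the form `⟨u, J v⟩` and whose successive lines lie in `W_i`. -/
def isoFlags (J : EuclideanSpace ℝ ι →L[ℝ] EuclideanSpace ℝ ι)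
    (W : Fin k → Submodule ℝ (EuclideanSpace ℝ ι)) : Set (KFlag ι k) :=
  {V | (∀ i, V.space i ⊓ (V.prev i)ᗮ ≤ W i) ∧
    ∀ i, ∀ u ∈ V.space i, ∀ v ∈ V.space i, inner ℝ u (J v) = 0}

variable {J : EuclideanSpace ℝ ι →L[ℝ] EuclideanSpace ℝ ι}
  {W : Fin k → Submodule ℝ (EuclideanSpace ℝ ι)}

theorem frameFlag_mem_isoFlags {X : Fin k → EuclideanSpace ℝ ι} (hX : X ∈ isoFrames J W) :
    frameFlag X hX.1 ∈ isoFlags J W := by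
  refine ⟨fun i y hy => ?_, fun i u hu v hv => ?_⟩
  · obtain ⟨hy1, hy2⟩ := hy
    -- In the expansion of `y` along the frame, the terms before `i` vanish because `y` is
    -- orthogonal to the preceding space; only a multiple of `X i` remains.
    have h1 : (Submodule.span ℝ (X '' Iic i)).starProjection y = y :=
      Submodule.starProjection_eq_self_iff.2 hy1
    rw [starProjection_span_image_Iic hX.1, _root_.sum_apply,
      Finset.sum_eq_single i] at h1
    · rw [← h1, InnerProductSpace.rankOne_apply]
      exact Submodule.smul_mem _ _ (hX.2.1 i)
    · intro j hj hji
      have hj' : j < i := lt_of_le_of_ne (Finset.mem_Iic.1 hj) hji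
      have : inner ℝ (X j) y = 0 :=
        hy2 _ ((frameFlag X hX.1).le_prev hj' (Submodule.subset_span ⟨j, mem_Iic.2 le_rfl, rfl⟩))
      rw [InnerProductSpace.rankOne_apply, this, zero_smul]
    · simp
  · change u ∈ Submodule.span ℝ (X '' Iic i) at hu
    change v ∈ Submodule.span ℝ (X '' Iic i) at hv
    induction hu, hv using Submodule.span_induction₂ with
    | mem_mem x y hx hy =>
      obtain ⟨a, -, rfl⟩ := hx
      obtain ⟨b, -, rfl⟩ := hy
      exact hX.2.2 a b
    | zero_left => simp
    | zero_right => simp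
    | add_left x y z _ _ _ h1 h2 => rw [inner_add_left, h1, h2, add_zero]
    | add_right x y z _ _ _ h1 h2 => rw [map_add, inner_add_right, h1, h2, add_zero]
    | smul_left r x y _ _ h => rw [inner_smul_left, h, mul_zero]
    | smul_right r x y _ _ h => rw [map_smul, inner_smul_right, h, mul_zero]

/-- The bridge along which compactness, connectedness and local parametrizations pass from frames to
flags. -/
theorem proj_image_isoFlags :
    KFlag.proj '' isoFlags J W =
      (fun X => partialSum k _ (lineTuple X)) '' isoFrames J W := by
  ext p
  constructor
  · rintro ⟨V, ⟨hV, hiso⟩, rfl⟩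
    obtain ⟨X, hX, hXV, hspan⟩ := V.exists_frame
    refine ⟨X, ⟨hX, fun i => hV i (hXV i), fun i j => ?_⟩,
      (proj_eq_partialSum_of_space_eq hX hspan).symm⟩
    exact hiso (max i j) _ (V.mono (le_max_left i j) (hXV i).1) _
      (V.mono (le_max_right i j) (hXV j).1)
  · rintro ⟨X, hX, rfl⟩
    exact ⟨_, frameFlag_mem_isoFlags hX, proj_eq_partialSum_of_space_eq hX.1 fun i => rfl⟩

variable {A B : Fin k → Fin k → Prop}

theorem IsNested.isConnected_lineTuple_image (h : IsNested J W A B)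
    (hdim : ∀ i, Nat.card {j // A j i} + Nat.card {j // B j i} < Module.finrank ℝ (W i)) :
    IsConnected (lineTuple '' isoFrames J W) := by
  let W' : ℕ → Submodule ℝ (EuclideanSpace ℝ ι) := fun n => if hn : n < k then W ⟨n, hn⟩ else ⊥
  have hW' : (fun i : Fin k => W' i) = W := funext fun i => by simp [W']
  rw [← hW']
  refine FlagStrata.isConnected_lineTuple_image h.skew k fun m hm X hX => ?_
  -- Padding by zero is harmless: `exists_extension` asks only for membership, and only its
  -- conclusions for indices below `m` are used.
  let X' : Fin k → EuclideanSpace ℝ ι := fun j => if hj : (j : ℕ) < m then X ⟨j, hj⟩ else 0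
  have hX' : ∀ j, X' j ∈ W j := by
    intro j
    by_cases hj : (j : ℕ) < m
    · simpa [X', hj, W'] using hX ⟨j, hj⟩
    · simp [X', hj]
  obtain ⟨y, hy, hy0, hXy⟩ := h.exists_extension ⟨m, hm⟩ (hdim _) X' hX'
  refine ⟨y, by simpa [W', hm] using hy, hy0, fun j => ?_⟩
  simpa [X'] using hXy ⟨j, j.2.trans hm⟩ j.2

theorem IsNested.isSmoothSubmanifold_strata (h : IsNested J W A B)
    (hdim : ∀ i, Nat.card {j // A j i} + Nat.card {j // B j i} < Module.finrank ℝ (W i)) :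
    ∃ d : ℕ, d + (Nat.card {a : Fin k × Fin k // A a.1 a.2} +
        Nat.card {b : Fin k × Fin k // B b.1 b.2} + k) = ∑ i, Module.finrank ℝ (W i) ∧
      (IsCompact (isoFlags J W) ∧ IsConnected (isoFlags J W) ∧
        IsSmoothSubmanifold KFlag.proj (isoFlags J W) d) ∧
      (IsCompact (isoFrames J W) ∧ IsSmoothSubmanifold id (isoFrames J W) d) := by
  have hconn := h.isConnected_lineTuple_image hdim
  have hne : (isoFrames J W).Nonempty := hconn.1.of_image
  obtain ⟨X₀, hX₀⟩ := hne
  obtain ⟨N₀, _, _, _, hN₀, -⟩ := h.isLocallyParametrized_isoFrames hX₀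
  have himage : KFlag.proj '' isoFlags J W = partialSum k _ '' (lineTuple '' isoFrames J W) := by
    rw [proj_image_isoFlags, image_image]
  refine ⟨Module.finrank ℝ N₀, hN₀, ⟨?_, ?_, ?_⟩, isCompact_isoFrames, ?_⟩
  · rw [isInducing_proj.isCompact_iff, himage]
    exact (isCompact_isoFrames.image continuous_lineTuple).image (partialSum k _).continuous
  · refine ⟨⟨_, frameFlag_mem_isoFlags hX₀⟩, ?_⟩
    rw [← isInducing_proj.isPreconnected_image, himage]
    exact hconn.2.image _ (partialSum k _).continuous.continuousOn
  · refine isSmoothSubmanifold_of_isLocallyParametrized isInducing_proj injective_proj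
      ⟨_, frameFlag_mem_isoFlags hX₀⟩ fun F hF => ?_
    have hF' := mem_image_of_mem KFlag.proj hF
    rw [proj_image_isoFlags] at hF' ⊢
    obtain ⟨X, hX, hXF⟩ := hF'
    obtain ⟨N, i₁, i₂, i₃, hN, hp⟩ := h.isLocallyParametrized_isoFrames hX
    rw [← hXF]
    exact ⟨N, i₁, i₂, i₃, by omega, isLocallyParametrized_flags hp hX⟩
  · refine isSmoothSubmanifold_of_isLocallyParametrized IsInducing.id injective_id
      ⟨X₀, hX₀⟩ fun X hX => ?_
    obtain ⟨N, i₁, i₂, i₃, hN, hp⟩ := h.isLocallyParametrized_isoFrames hX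
    exact ⟨N, i₁, i₂, i₃, by omega, by rwa [image_id]⟩

end

/-! ### Eigen-directions -/

theorem coordSpan_mono {ι : Type} [Fintype ι]
    {E : ι → Submodule ℝ (EuclideanSpace ℝ ι)}
    {I K : Finset ι} (h : I ⊆ K) : coordSpan E I ≤ coordSpan E K :=
  biSup_mono h

theorem coordSpan_singleton {ι : Type} [Fintype ι]
    (E : ι → Submodule ℝ (EuclideanSpace ℝ ι)) (i : ι) :
    coordSpan E {i} = E i := by
  simp [coordSpan]

section

variable {ι : Type} [Fintype ι] [DecidableEq ι]

/-- If `H` contains an element with distinct eigenvalues, its eigen-directions are spanned by an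
orthonormal family. -/
theorem IsEigenDirections.exists_orthonormal {H : Set (Matrix ι ι ℝ)}
    {E : ι → Submodule ℝ (EuclideanSpace ℝ ι)} (hE : IsEigenDirections H E) {Q : Matrix ι ι ℝ}
    (hQ : Q ∈ Matrix.orthogonalGroup ι ℝ) {d : ι → ℝ} (hd : Injective d)
    (hH : Q * Matrix.diagonal d * Q⁻¹ ∈ H) :
    ∃ b : ι → EuclideanSpace ℝ ι, Orthonormal ℝ b ∧ ∀ i, E i = Submodule.span ℝ {b i} := by
  have hQ1 : Q.transpose * Q = 1 := (Matrix.mem_orthogonalGroup_iff' ι ℝ).1 hQ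
  have hQ2 : Q * Q.transpose = 1 := (Matrix.mem_orthogonalGroup_iff ι ℝ).1 hQ
  have hQinv : Q⁻¹ = Q.transpose := Matrix.inv_eq_left_inv hQ1
  have hb : ∀ i, ∃ b ∈ E i, ‖b‖ = 1 := by
    intro i
    have hne : E i ≠ ⊥ := fun h => by
      have := hE.finrank_eq_one i
      rw [h, finrank_bot] at this
      exact zero_ne_one this
    obtain ⟨y, hy, hy0⟩ := Submodule.exists_mem_ne_zero_of_ne_bot hne
    exact ⟨‖y‖⁻¹ • y, Submodule.smul_mem _ _ hy, norm_smul_inv_norm hy0⟩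
  choose b hbE hb1 using hb
  have hspan : ∀ i, E i = Submodule.span ℝ {b i} := fun i =>
    (Submodule.eq_of_le_of_finrank_eq
      ((Submodule.span_singleton_le_iff_mem _ _).2 (hbE i)) (by
        rw [hE.finrank_eq_one,
          finrank_span_singleton (norm_ne_zero_iff.1 (by rw [hb1]; exact one_ne_zero))])).symm
  -- Coordinates of `b i` in the orthonormal basis of columns of `Q`, where the chosen element of
  -- `H` acts as the diagonal matrix of `d`.
  let w : ι → ι → ℝ := fun i => Q.transpose.mulVec (b i).ofLp
  have hw : ∀ i, Q.mulVec (w i) = (b i).ofLp := fun i => by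
    simp only [w]
    rw [Matrix.mulVec_mulVec, hQ2, Matrix.one_mulVec]
  have heig : ∀ i, ∃ c : ℝ, ∀ p, d p * w i p = c * w i p := by
    intro i
    have h1 : Matrix.toEuclideanLin (Q * Matrix.diagonal d * Q⁻¹) (b i) ∈ E i := by
      rw [← hE.invariant _ hH i]
      exact Submodule.mem_map_of_mem (hbE i)
    rw [hspan i] at h1
    obtain ⟨c, hc⟩ := Submodule.mem_span_singleton.1 h1
    refine ⟨c, fun p => ?_⟩
    have h2 : c • (b i).ofLp = (Q * Matrix.diagonal d * Q⁻¹).mulVec (b i).ofLp :=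
      congrArg WithLp.ofLp hc
    have h3 := congrArg Q.transpose.mulVec h2
    rw [Matrix.mulVec_smul, hQinv, Matrix.mulVec_mulVec, ← mul_assoc, ← mul_assoc, hQ1, one_mul,
      ← Matrix.mulVec_mulVec] at h3
    have h4 := congrFun h3 p
    rw [Matrix.mulVec_diagonal] at h4
    exact h4.symm
  have hinner : ∀ i j, inner ℝ (b i) (b j) = ∑ p, w i p * w j p := by
    intro i j
    rw [EuclideanSpace.inner_eq_star_dotProduct, ← hw i, ← hw j, star_trivial,
      Matrix.dotProduct_mulVec, Matrix.vecMul_mulVec, hQ1, Matrix.vecMul_one, dotProduct]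
    exact Finset.sum_congr rfl fun p _ => mul_comm _ _
  refine ⟨b, ⟨hb1, fun i j hij => ?_⟩, hspan⟩
  change inner ℝ (b i) (b j) = 0
  rw [hinner]
  refine Finset.sum_eq_zero fun p _ => ?_
  by_contra hne
  have hi : w i p ≠ 0 := left_ne_zero_of_mul hne
  have hj : w j p ≠ 0 := right_ne_zero_of_mul hne
  -- As the entries of `d` are distinct, an eigenvector is supported on one coordinate. Two sharing
  -- it would be proportional, against directness of the sum.
  have hsupp : ∀ l, w l p ≠ 0 → ∀ q, q ≠ p → w l q = 0 := by
    intro l hl q hq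
    obtain ⟨c, hc⟩ := heig l
    have h1 : d p = c := mul_right_cancel₀ hl (hc p)
    by_contra h0
    exact hq (hd ((mul_right_cancel₀ h0 (hc q)).trans h1.symm))
  have hprop : w i p • w j = w j p • w i := by
    funext q
    by_cases hq : q = p
    · subst hq; simp [mul_comm]
    · simp [hsupp i hi q hq, hsupp j hj q hq]
  have hb' : w i p • b j = w j p • b i := by
    ext q
    have := congrFun (congrArg Q.mulVec hprop) q
    rw [Matrix.mulVec_smul, Matrix.mulVec_smul, hw, hw] at this
    simpa using this
  have hdisj : Disjoint (E i) (E j) := hE.isInternal.submodule_iSupIndep.pairwiseDisjoint hij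
  have h0 : w i p • b j = 0 := (Submodule.disjoint_def.1 hdisj) _
    (by rw [hb']; exact Submodule.smul_mem _ _ (hbE i)) (Submodule.smul_mem _ _ (hbE j))
  have := hb1 j
  rw [(smul_eq_zero.1 h0).resolve_left hi, norm_zero] at this
  exact zero_ne_one this

end

section

variable {ι : Type} [Fintype ι] {E : ι → Submodule ℝ (EuclideanSpace ℝ ι)} {b : ι → EuclideanSpace ℝ ι}

theorem finrank_coordSpan (hb : Orthonormal ℝ b) (hE : ∀ i, E i = Submodule.span ℝ {b i})
    (I : Finset ι) : Module.finrank ℝ (coordSpan E I) = I.card := by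
  have h1 : coordSpan E I = Submodule.span ℝ (range fun i : I => b i) := by
    rw [Submodule.span_range_eq_iSup, iSup_subtype]
    simp only [coordSpan, hE]
  have h2 : LinearIndependent ℝ fun i : I => b i :=
    hb.linearIndependent.comp _ Subtype.val_injective
  rw [h1, finrank_span_eq_card h2]
  simp

theorem inner_eq_zero_of_disjoint (hb : Orthonormal ℝ b) (hE : ∀ i, E i = Submodule.span ℝ {b i})
    {I K : Finset ι} (h : Disjoint I K) {x y : EuclideanSpace ℝ ι} (hx : x ∈ coordSpan E I)
    (hy : y ∈ coordSpan E K) : inner ℝ x y = 0 := by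
  have : coordSpan E I ⟂ coordSpan E K := by
    simp only [coordSpan, Submodule.isOrtho_iSup_left, Submodule.isOrtho_iSup_right]
    intro i hi j hj
    rw [hE, hE, Submodule.isOrtho_span]
    rintro _ rfl _ rfl
    exact hb.2 fun hij => Finset.disjoint_left.1 h hj (hij ▸ hi)
  exact this.inner_eq hx hy

end

/-! ### The general linear case -/

theorem exists_orthonormal_of_specialLinear {n : ℕ} {H : Set (Matrix (Fin n) (Fin n) ℝ)}
    {E : Fin n → Submodule ℝ (EuclideanSpace ℝ (Fin n))}
    (hH : IsCommPosSymm (specialLinear n) H) (hE : IsEigenDirections H E) :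
    ∃ b : Fin n → EuclideanSpace ℝ (Fin n), Orthonormal ℝ b ∧
      ∀ i, E i = Submodule.span ℝ {b i} := by
  obtain ⟨Q, -, hQ, rfl⟩ := hH
  -- Subtracting the mean makes the exponents sum to zero, so the determinant is one.
  let c : ℝ := (∑ i : Fin n, (i : ℝ)) / n
  let d : Fin n → ℝ := fun i => Real.exp (i - c)
  have hd : Injective d := fun i j hij => by
    have := Real.exp_injective hij
    exact Fin.ext (by exact_mod_cast sub_left_injective this)
  refine hE.exists_orthonormal hQ hd ⟨_, ⟨?_, d, fun i => Real.exp_pos _, rfl⟩, rfl⟩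
  rw [specialLinear, MonoidHom.mem_mker, Matrix.coe_detMonoidHom, Matrix.det_diagonal,
    ← Real.exp_sum, Real.exp_eq_one_iff, Finset.sum_sub_distrib, Finset.sum_const,
    Finset.card_univ, Fintype.card_fin, nsmul_eq_mul]
  rcases n.eq_zero_or_pos with rfl | hn
  · simp
  · have : (n : ℝ) ≠ 0 := by positivity
    rw [mul_div_cancel₀ _ this, sub_self]

/-! ### The symplectic case -/

theorem Jmap_apply_inl {n : ℕ} (x : EuclideanSpace ℝ (Fin n ⊕ Fin n)) (i : Fin n) :
    Jmap n x (Sum.inl i) = -x (Sum.inr i) := by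
  simp [Jmap, Matrix.toLpLin_apply, Matrix.J, Matrix.mulVec, dotProduct, Matrix.one_apply]

theorem Jmap_apply_inr {n : ℕ} (x : EuclideanSpace ℝ (Fin n ⊕ Fin n)) (i : Fin n) :
    Jmap n x (Sum.inr i) = x (Sum.inl i) := by
  simp [Jmap, Matrix.toLpLin_apply, Matrix.J, Matrix.mulVec, dotProduct, Matrix.one_apply]

theorem Jmap_Jmap {n : ℕ} (x : EuclideanSpace ℝ (Fin n ⊕ Fin n)) : Jmap n (Jmap n x) = -x := by
  ext (i | i)
  · simp [Jmap_apply_inl, Jmap_apply_inr]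
  · simp [Jmap_apply_inl, Jmap_apply_inr]

theorem inner_Jmap_left {n : ℕ} (x y : EuclideanSpace ℝ (Fin n ⊕ Fin n)) :
    inner ℝ (Jmap n x) y = -inner ℝ x (Jmap n y) := by
  simp only [PiLp.inner_apply, Fintype.sum_sum_type, Jmap_apply_inl, Jmap_apply_inr]
  simp [Finset.sum_neg_distrib, add_comm]

theorem inner_self_Jmap {n : ℕ} (x : EuclideanSpace ℝ (Fin n ⊕ Fin n)) :
    inner ℝ x (Jmap n x) = 0 :=
  inner_apply_self_of_skew (J := (Jmap n).toContinuousLinearMap) inner_Jmap_left x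

/-- The numbering hypothesis covers the first half of the indices; `J² = -1` gives the other half.
-/
theorem Jmap_mem_swap {n : ℕ} {E : Fin n ⊕ Fin n → Submodule ℝ (EuclideanSpace ℝ (Fin n ⊕ Fin n))}
    (hJ : ∀ i : Fin n, (E (Sum.inl i)).map (Jmap n) = E (Sum.inr i)) (i : Fin n ⊕ Fin n)
    {x : EuclideanSpace ℝ (Fin n ⊕ Fin n)} (hx : x ∈ E i) : Jmap n x ∈ E i.swap := by
  rcases i with i | i
  · rw [Sum.swap_inl, ← hJ]
    exact Submodule.mem_map_of_mem hx
  · rw [← hJ] at hx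
    obtain ⟨y, hy, rfl⟩ := hx
    rw [Jmap_Jmap]
    exact neg_mem hy

theorem Jmap_mem_coordSpan {n : ℕ}
    {E : Fin n ⊕ Fin n → Submodule ℝ (EuclideanSpace ℝ (Fin n ⊕ Fin n))}
    (hJ : ∀ i : Fin n, (E (Sum.inl i)).map (Jmap n) = E (Sum.inr i))
    {I : Finset (Fin n ⊕ Fin n)} {x : EuclideanSpace ℝ (Fin n ⊕ Fin n)}
    (hx : x ∈ coordSpan E I) : Jmap n x ∈ coordSpan E (conj I) := by
  have h : coordSpan E I ≤ (coordSpan E (conj I)).comap (Jmap n) :=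
    iSup₂_le fun i hi y hy => Submodule.mem_iSup_of_mem i.swap
      (Submodule.mem_iSup_of_mem (Finset.mem_image_of_mem _ hi) (Jmap_mem_swap hJ i hy))
  exact h hx

theorem exists_orthonormal_of_symplectic {n : ℕ}
    {H : Set (Matrix (Fin n ⊕ Fin n) (Fin n ⊕ Fin n) ℝ)}
    {E : Fin n ⊕ Fin n → Submodule ℝ (EuclideanSpace ℝ (Fin n ⊕ Fin n))}
    (hH : IsCommPosSymm (Matrix.symplecticGroup (Fin n) ℝ) H) (hE : IsEigenDirections H E) :
    ∃ b : Fin n ⊕ Fin n → EuclideanSpace ℝ (Fin n ⊕ Fin n), Orthonormal ℝ b ∧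
      ∀ i, E i = Submodule.span ℝ {b i} := by
  obtain ⟨Q, -, hQ, rfl⟩ := hH
  -- Opposite exponents on conjugate indices make the diagonal matrix symplectic; the shift by one
  -- keeps the two halves distinct at index zero.
  let a : Fin n ⊕ Fin n → ℝ := Sum.elim (fun i => (i : ℝ) + 1) fun i => -((i : ℝ) + 1)
  let d : Fin n ⊕ Fin n → ℝ := fun i => Real.exp (a i)
  have hd : Injective d := by
    refine Real.exp_injective.comp ?_
    rintro (i | i) (j | j) hij <;> simp only [a, Sum.elim_inl, Sum.elim_inr] at hij
    · exact congrArg _ (Fin.ext (by exact_mod_cast add_right_cancel hij))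
    · have := (i : ℕ).cast_nonneg (α := ℝ)
      have := (j : ℕ).cast_nonneg (α := ℝ)
      linarith
    · have := (i : ℕ).cast_nonneg (α := ℝ)
      have := (j : ℕ).cast_nonneg (α := ℝ)
      linarith
    · exact congrArg _ (Fin.ext (by exact_mod_cast add_right_cancel (neg_injective hij)))
  refine hE.exists_orthonormal hQ hd ⟨_, ⟨?_, d, fun i => Real.exp_pos _, rfl⟩, rfl⟩
  rw [SymplecticGroup.mem_iff, Matrix.diagonal_transpose]
  ext (i | i) (j | j) <;>
    simp only [Matrix.mul_diagonal, Matrix.diagonal_mul, Matrix.J, Matrix.fromBlocks_apply₁₁,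
      Matrix.fromBlocks_apply₁₂, Matrix.fromBlocks_apply₂₁, Matrix.fromBlocks_apply₂₂,
      Matrix.zero_apply, Matrix.neg_apply, Matrix.one_apply, mul_zero, zero_mul]
  · split_ifs with hij
    · subst hij
      simp [d, a, ← Real.exp_add]
    · simp
  · split_ifs with hij
    · subst hij
      simp [d, a, ← Real.exp_add]
    · simp

/-! ### Disconnected frame strata -/

section

variable {ι : Type} [Fintype ι] [DecidableEq ι]

/-- The coordinate axes. -/
def axes (ι : Type) [Fintype ι] [DecidableEq ι] (i : ι) : Submodule ℝ (EuclideanSpace ℝ ι) :=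
  Submodule.span ℝ {EuclideanSpace.single i 1}

theorem isCommPosSymm_posDiag (G : Submonoid (Matrix ι ι ℝ)) : IsCommPosSymm G (posDiag G) :=
  ⟨1, one_mem _, one_mem _, by simp⟩

theorem isEigenDirections_axes (G : Submonoid (Matrix ι ι ℝ)) :
    IsEigenDirections (posDiag G) (axes ι) where
  finrank_eq_one i := finrank_span_singleton (by simp)
  invariant := by
    rintro _ ⟨-, d, hd, rfl⟩ i
    have : Matrix.toEuclideanLin (Matrix.diagonal d) (EuclideanSpace.single i 1) =
        d i • EuclideanSpace.single i (1 : ℝ) := by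
      ext j
      by_cases h : j = i
      · subst h; simp [Matrix.toLpLin_apply]
      · simp [Matrix.toLpLin_apply, h]
    rw [axes, Submodule.map_span, image_singleton, this]
    exact Submodule.span_singleton_smul_eq (hd i).ne'.isUnit _
  isInternal := by
    refine DirectSum.isInternal_submodule_of_iSupIndep_of_iSup_eq_top ?_ ?_
    · have := (EuclideanSpace.basisFun ι ℝ).toBasis.linearIndependent.iSupIndep_span_singleton
      simpa [axes] using! this
    · have := (EuclideanSpace.basisFun ι ℝ).toBasis.span_eq
      rw [Submodule.span_range_eq_iSup] at this
      simpa [axes] using! this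

/-- The `i`-th coordinate takes the values `1` and `-1` on `S` but never `0`, since the only column
is a unit vector on the `i`-th axis. -/
theorem not_isPreconnected_of_line {i : ι} {S : Set (Fin 1 → EuclideanSpace ℝ ι)}
    (hS : S ⊆ frameStratum (axes ι) fun _ => {i})
    (h1 : (fun _ => EuclideanSpace.single i 1) ∈ S)
    (h2 : (fun _ => -EuclideanSpace.single i 1) ∈ S) : ¬ IsPreconnected S := by
  intro h
  have hc : Continuous fun X : Fin 1 → EuclideanSpace ℝ ι => X 0 i := by fun_prop
  have hI := (h.image _ hc.continuousOn).ordConnected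
  obtain ⟨X, hX, hX0⟩ := hI.out (mem_image_of_mem _ h2) (mem_image_of_mem _ h1)
    (show (0 : ℝ) ∈ Icc _ _ by simp)
  obtain ⟨ho, hm⟩ := hS hX
  have := hm 0
  rw [coordSpan_singleton, axes, Submodule.mem_span_singleton] at this
  obtain ⟨c, hc⟩ := this
  have hc0 : c = 0 := by
    have h3 : X 0 i = 0 := hX0
    rw [← hc] at h3
    simpa using h3
  have := ho.1 0
  rw [← hc, hc0, zero_smul, norm_zero] at this
  exact zero_ne_one this

theorem single_mem_frameStratum (i : ι) {s : ℝ} (hs : |s| = 1) :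
    (fun _ => s • EuclideanSpace.single i 1) ∈
      frameStratum (k := 1) (axes ι) fun _ => {i} := by
  refine ⟨⟨fun _ => by simp [norm_smul, hs], fun a b hab => absurd (Subsingleton.elim a b) hab⟩,
    fun _ => ?_⟩
  rw [coordSpan_singleton]
  exact Submodule.smul_mem _ _ (Submodule.mem_span_singleton_self _)

end

theorem card_pairs {k : ℕ} (R : Fin k → Fin k → Prop) [DecidableRel R] :
    Nat.card {a : Fin k × Fin k // R a.1 a.2} =
      (Finset.univ.filter fun p : Fin k × Fin k => R p.1 p.2).card := by
  rw [Nat.card_eq_fintype_card, Fintype.card_subtype]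

end FlagStrata

end

/-! ### The special linear and symplectic cases, with their disconnected examples. -/

open FlagStrata in
theorem mainTheorem6 :
    -- the general case
    (∀ (n k : ℕ) (H : Set (Matrix (Fin n) (Fin n) ℝ))
        (E : Fin n → Submodule ℝ (EuclideanSpace ℝ (Fin n))) (P : Fin k → Finset (Fin n)),
        IsCommPosSymm (specialLinear n) H → IsEigenDirections H E →
        IsTree P → IsConsistent P →
        ∃ d : ℕ, (d : ℤ) = (∑ i, ((P i).card : ℤ)) - k - kappa P ∧
          (IsCompact (flagStratum E P) ∧ IsConnected (flagStratum E P) ∧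
            IsSmoothSubmanifold KFlag.proj (flagStratum E P) d) ∧
          (IsCompact (frameStratum E P) ∧ IsSmoothSubmanifold id (frameStratum E P) d)) ∧
    -- the frame strata may be disconnected
    (∃ (n k : ℕ) (H : Set (Matrix (Fin n) (Fin n) ℝ))
        (E : Fin n → Submodule ℝ (EuclideanSpace ℝ (Fin n))) (P : Fin k → Finset (Fin n)),
        IsCommPosSymm (specialLinear n) H ∧ IsEigenDirections H E ∧
        IsTree P ∧ IsConsistent P ∧ ¬ IsPreconnected (frameStratum E P)) ∧
    -- the symplectic case
    (∀ (n k : ℕ) (H : Set (Matrix (Fin n ⊕ Fin n) (Fin n ⊕ Fin n) ℝ))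
        (E : Fin n ⊕ Fin n → Submodule ℝ (EuclideanSpace ℝ (Fin n ⊕ Fin n)))
        (P : Fin k → Finset (Fin n ⊕ Fin n)),
        IsCommPosSymm (Matrix.symplecticGroup (Fin n) ℝ) H → IsEigenDirections H E →
        (∀ i : Fin n, (E (Sum.inl i)).map (Jmap n) = E (Sum.inr i)) →
        IsSympTree P → IsSympConsistent P →
        ∃ d : ℕ, (d : ℤ) = (∑ i, ((P i).card : ℤ)) - k - kappa P - mu P ∧
          (IsCompact (sympFlagStratum E P) ∧ IsConnected (sympFlagStratum E P) ∧
            IsSmoothSubmanifold KFlag.proj (sympFlagStratum E P) d) ∧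
          (IsCompact (sympFrameStratum E P) ∧
            IsSmoothSubmanifold id (sympFrameStratum E P) d)) ∧
    -- the symplectic frame strata may be disconnected
    (∃ (n k : ℕ) (H : Set (Matrix (Fin n ⊕ Fin n) (Fin n ⊕ Fin n) ℝ))
        (E : Fin n ⊕ Fin n → Submodule ℝ (EuclideanSpace ℝ (Fin n ⊕ Fin n)))
        (P : Fin k → Finset (Fin n ⊕ Fin n)),
        IsCommPosSymm (Matrix.symplecticGroup (Fin n) ℝ) H ∧ IsEigenDirections H E ∧
        (∀ i : Fin n, (E (Sum.inl i)).map (Jmap n) = E (Sum.inr i)) ∧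
        IsSympTree P ∧ IsSympConsistent P ∧ ¬ IsPreconnected (sympFrameStratum E P)) := by
  refine ⟨?_, ?_, ?_, ?_⟩
  · intro n k H E P hH hE hT hC
    obtain ⟨b, hb, hbE⟩ := exists_orthonormal_of_specialLinear hH hE
    -- With `J = 0` the isotropy condition is vacuous and no pair needs to be selected by `B`.
    have hW : IsNested (0 : EuclideanSpace ℝ (Fin n) →L[ℝ] EuclideanSpace ℝ (Fin n))
        (fun i => coordSpan E (P i)) (fun j i => j < i ∧ P j ⊆ P i) (fun _ _ => False) :=
      { skew := by simp
        isometry := fun _ _ h => h.elim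
        lt_left := fun _ _ h => h.1
        le_left := fun _ _ h => coordSpan_mono h.2
        lt_right := fun _ _ h => h.elim
        le_right := fun _ _ h => h.elim
        orth_left := fun j i hji h x hx y hy => inner_eq_zero_of_disjoint hb hbE
          (Finset.disjoint_iff_inter_eq_empty.2
            ((hT j i hji).resolve_right fun h' => h ⟨hji, h'⟩)) hx hy
        orth_right := by simp }
    obtain ⟨d, hd, hflag, hframe⟩ := hW.isSmoothSubmanifold_strata fun i => by
      have := hC i
      rw [finrank_coordSpan hb hbE, Nat.card_eq_fintype_card, Fintype.card_subtype]
      simpa [depth] using this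
    have e1 : isoFlags 0 (fun i => coordSpan E (P i)) = flagStratum E P := by
      simp [isoFlags, flagStratum]
    have e2 : isoFrames 0 (fun i => coordSpan E (P i)) = frameStratum E P := by
      simp [isoFrames, frameStratum]
    rw [e1] at hflag
    rw [e2] at hframe
    refine ⟨d, ?_, hflag, hframe⟩
    simp only [finrank_coordSpan hb hbE, card_pairs fun j i => j < i ∧ P j ⊆ P i] at hd
    rw [← Nat.cast_sum, ← hd, kappa]
    simp
    ring
  -- One column confined to one axis: the frame stratum consists of the two unit vectors on it.
  · refine ⟨2, 1, posDiag (specialLinear 2), axes (Fin 2), fun _ => {0}, isCommPosSymm_posDiag _,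
      isEigenDirections_axes _, fun i j hij => absurd hij (by omega), fun i => ?_,
      not_isPreconnected_of_line (le_refl _) ?_ ?_⟩
    · simp [depth]
    · simpa using single_mem_frameStratum (0 : Fin 2) abs_one
    · simpa using single_mem_frameStratum (0 : Fin 2) (s := -1) (by simp)
  · intro n k H E P hH hE hJ hT hC
    obtain ⟨b, hb, hbE⟩ := exists_orthonormal_of_symplectic hH hE
    let J := (Jmap n).toContinuousLinearMap
    have hW : IsNested J (fun i => coordSpan E (P i)) (fun j i => j < i ∧ P j ⊆ P i)
        (fun j i => j < i ∧ conj (P j) ⊆ P i) :=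
      { skew := inner_Jmap_left
        isometry := fun _ _ _ x y => by
          change inner ℝ (Jmap n x) (Jmap n y) = _
          rw [inner_Jmap_left, Jmap_Jmap, inner_neg_right, neg_neg]
        lt_left := fun _ _ h => h.1
        le_left := fun _ _ h => coordSpan_mono h.2
        lt_right := fun _ _ h => h.1
        le_right := fun _ _ h x hx => coordSpan_mono h.2 (Jmap_mem_coordSpan hJ hx)
        orth_left := fun j i hji h x hx y hy => inner_eq_zero_of_disjoint hb hbE
          (Finset.disjoint_iff_inter_eq_empty.2
            ((hT j i hji).1.resolve_right fun h' => h ⟨hji, h'⟩)) hx hy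
        orth_right := fun j i hji h x hx y hy => inner_eq_zero_of_disjoint hb hbE
          (Finset.disjoint_iff_inter_eq_empty.2
            ((hT j i hji).2.resolve_right fun h' => h ⟨hji, h'⟩)) (Jmap_mem_coordSpan hJ hx) hy }
    obtain ⟨d, hd, hflag, hframe⟩ := hW.isSmoothSubmanifold_strata fun i => by
      have := hC i
      rw [finrank_coordSpan hb hbE, Nat.card_eq_fintype_card, Fintype.card_subtype,
        Nat.card_eq_fintype_card, Fintype.card_subtype]
      exact this
    have e1 : isoFlags J (fun i => coordSpan E (P i)) = sympFlagStratum E P := rfl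
    have e2 : isoFrames J (fun i => coordSpan E (P i)) = sympFrameStratum E P := by
      ext X
      exact and_assoc.symm
    rw [e1] at hflag
    rw [e2] at hframe
    refine ⟨d, ?_, hflag, hframe⟩
    simp only [finrank_coordSpan hb hbE, card_pairs fun j i => j < i ∧ P j ⊆ P i,
      card_pairs fun j i => j < i ∧ conj (P j) ⊆ P i] at hd
    rw [← Nat.cast_sum, ← hd, kappa, mu]
    push_cast
    ring
  · refine ⟨2, 1, posDiag (Matrix.symplecticGroup (Fin 2) ℝ), axes (Fin 2 ⊕ Fin 2),
      fun _ => {Sum.inl 0}, isCommPosSymm_posDiag _, isEigenDirections_axes _, fun i => ?_,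
      fun i j hij => absurd hij (by omega), fun i => ?_,
      not_isPreconnected_of_line Set.inter_subset_left ⟨?_, ?_⟩ ⟨?_, ?_⟩⟩
    · rw [axes, axes, Submodule.map_span, Set.image_singleton]
      congr 2
      ext (j | j)
      · simp [Jmap_apply_inl]
      · simp [Jmap_apply_inr]
    · simp [depth, coDepth]
    · simpa using single_mem_frameStratum (Sum.inl 0 : Fin 2 ⊕ Fin 2) abs_one
    · exact fun _ _ => inner_self_Jmap _
    · simpa using single_mem_frameStratum (Sum.inl 0 : Fin 2 ⊕ Fin 2) (s := -1) (by simp)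
    · exact fun _ _ => inner_self_Jmap _
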